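/- Let $\mathcal S,\mathcal X,\mathcal Y,\mathcal Z$ be finite sets with $\mathcal S,\mathcal X$ nonempty, and let $W_{YZ|XS}$ be a channel from $\mathcal X\times\mathcal S$ to $\mathcal Y\times\mathcal Z$, with marginals $W_{Y|X,s}$ and $W_{Z|X,s}$ for $s\in\mathcal S$. The channel is used memorylessly, with a state $s$ that is unknown and fixed during the whole transmission. An open-loop code of length $n$ consists of a number of messages $M\ge 1$, an encoder $f:\{1,\dots,M\}\to\mathcal X^n$, a state estimator $g:\mathcal X^n\times\mathcal Z^n\to\mathcal S$ and a decoder $h:\mathcal Y^n\to\{1,\dots,M\}$. Its communication-error and detection-error probabilities are $$P_c=\max_{s}\max_{w}\mathbb P\big(h(Y^n)\ne w\mid X^n=f(w),S=s\big),\qquad P_d=\max_{s}\max_{w}\mathbb P\big(g(X^n,Z^n)\ne s\mid X^n=f(w),S=s\big).$$ A pair $(R,E)\in\mathbb R_+^2$ is achievable if for every $\epsilon>0$ there are arbitrarily large $n$ for which there is an open-loop code of length $n$ with $P_c\le\epsilon$, $-\frac1n\log P_d\ge E-\epsilon$ and $\frac1n\log M\ge R-\epsilon$. Let $\mathbf C_{\mathrm{open}}^{(m)}$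 be the closure of the set of achievable pairs. Logarithms are natural and $-\log 0=+\infty$. For a probability distribution $P_X$ on $\mathcal X$ let $\mathbb I(P_X,W_{Y|X,s})$ be the mutual information between the input and the output of $W_{Y|X,s}$ when the input has distribution $P_X$, and let $$\phi(P_X)=\min_{s\in\mathcal S}\ \min_{s'\ne s}\ \sup_{\ell\in[0,1]}\ -\sum_{x}P_X(x)\log\Big(\sum_z W_{Z|X,s}(z|x)^{\ell}\,W_{Z|X,s'}(z|x)^{1-\ell}\Big)\in[0,+\infty],$$ where $0\cdot(+\infty)=0$, $0^0=1$, and the minimum over the empty set (when $|\mathcal S|=1$) is $+\infty$. Suppose that there is $x_0\in\mathcal X$ such that for every $x\in\mathcal X$ there is a permutation $\pi_x$ of $\mathcal Z$ with $$W_{Z|X,s}(z|x)=W_{Z|X,s}(\pi_x(z)|x_0)\qquad\text{for all } s\in\mathcal S,\ z\in\mathcal Z.$$ Then $\phi(P_X)$ does not depend on $P_X$, the two maxima below are attained, and $$\mathbf C_{\mathrm{open}}^{(m)}=\Big\{(R,E)\in\mathbb R_+^2:\ R\le\max_{P_X}\min_{s\in\mathcal S}\mathbb I(P_X,W_{Y|X,s}),\quad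 E\le\max_{P_X}\phi(P_X)\Big\}.$$ -/

import Mathlib

open scoped BigOperators

noncomputable section

namespace JointCommSensing

variable {S X Y Z : Type*} [Fintype X] [Fintype Y] [Fintype Z]

/-- The marginal communication channel `W_{Y|X,s}(y|x)` of the state-dependent memoryless channel
`W_{YZ|XS}`, given as `W s x = W_{YZ|XS}(·|x,s)`. -/
def chanY (W : S → X → stdSimplex ℝ (Y × Z)) (s : S) (x : X) (y : Y) : ℝ :=
  ∑ z, W s x (y, z)

/-- The marginal sensing channel `W_{Z|X,s}(z|x)`. -/
def chanZ (W : S → X → stdSimplex ℝ (Y × Z)) (s : S) (x : X) (z : Z) : ℝ :=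
  ∑ y, W s x (y, z)

/-- Shannon entropy in nats; `Real.negMulLog t = -t log t`. -/
def entropy {A : Type*} [Fintype A] (p : A → ℝ) : ℝ :=
  ∑ a, Real.negMulLog (p a)

/-- Mutual information `I(P, V) = H(P ∘ V) - H(V | P)`. -/
def mutualInfo (P : stdSimplex ℝ X) (V : X → Y → ℝ) : ℝ :=
  entropy (fun y => ∑ x, P x * V x y) - ∑ x, P x * entropy (V x)

/-- `min_s I(P, W_{Y|X,s})`. -/
def compoundInfo [Fintype S] [Nonempty S] (W : S → X → stdSimplex ℝ (Y × Z))
    (P : stdSimplex ℝ X) : ℝ :=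
  Finset.univ.inf' Finset.univ_nonempty fun s => mutualInfo P (chanY W s)

/-- `-log t` for `t ≥ 0`, with `-log 0 = +∞`. -/
def negLog (t : ℝ) : EReal :=
  -ENNReal.log (ENNReal.ofReal t)

/-- `φ(P) = min_s min_{s' ≠ s} sup_{ℓ ∈ [0,1]} - ∑_x P(x) log ∑_z W_s(z|x)^ℓ W_{s'}(z|x)^{1-ℓ}`,
with values in `[0, +∞]`; here `0 · (+∞) = 0`, and the minimum over an empty set is `+∞`. -/
def phi (W : S → X → stdSimplex ℝ (Y × Z)) (P : stdSimplex ℝ X) : EReal :=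
  ⨅ (s : S) (s' : S) (_ : s' ≠ s), ⨆ ℓ ∈ Set.Icc (0 : ℝ) 1,
    ∑ x, (P x : EReal) * negLog (∑ z, chanZ W s x z ^ ℓ * chanZ W s' x z ^ (1 - ℓ))

/-- An open-loop code of length `n`: the encoder does not use the observations `Z^{i-1}`. -/
structure OpenLoopCode (S X Y Z : Type*) (n : ℕ) where
  /-- The number of messages. -/
  M : ℕ
  M_pos : 0 < M
  /-- The encoder, mapping a message to its codeword. -/
  enc : Fin M → Fin n → X
  /-- The state estimator at the transmitter, which knows the codeword. -/
  est : (Fin n → X) → (Fin n → Z) → S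
  /-- The message decoder at the receiver. -/
  dec : (Fin n → Y) → Fin M

/-- Probability that the outputs `(Y_i, Z_i)_i` lie in `A`, when the codeword `x` is sent over the
memoryless channel whose state is `s` during the whole transmission. -/
def outProb {n : ℕ} (W : S → X → stdSimplex ℝ (Y × Z)) (s : S) (x : Fin n → X)
    (A : Set (Fin n → Y × Z)) : ℝ :=
  ∑ o : Fin n → Y × Z, A.indicator (fun o => ∏ i, W s (x i) (o i)) o

namespace OpenLoopCode

variable {n : ℕ}

/-- `P_c = max_s max_w ℙ(h(Y^n) ≠ w | W = w, S = s)`. The index set is finite and, when `S` is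
nonempty, nonempty. -/
def commError (C : OpenLoopCode S X Y Z n) (W : S → X → stdSimplex ℝ (Y × Z)) : ℝ :=
  ⨆ p : S × Fin C.M, outProb W p.1 (C.enc p.2) {o | C.dec (fun i => (o i).1) ≠ p.2}

/-- `P_d = max_s max_w ℙ(g(X^n, Z^n) ≠ s | W = w, S = s)`. -/
def detError (C : OpenLoopCode S X Y Z n) (W : S → X → stdSimplex ℝ (Y × Z)) : ℝ :=
  ⨆ p : S × Fin C.M,
    outProb W p.1 (C.enc p.2) {o | C.est (C.enc p.2) (fun i => (o i).2) ≠ p.1}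

/-- `R^{(n)} = (1/n) log M`. -/
def rate (C : OpenLoopCode S X Y Z n) : ℝ :=
  1 / (n : ℝ) * Real.log C.M

/-- `E_d^{(n)} = -(1/n) log P_d`, which is `+∞` when `P_d = 0`. -/
def detExponent (C : OpenLoopCode S X Y Z n) (W : S → X → stdSimplex ℝ (Y × Z)) : EReal :=
  ((1 / (n : ℝ) : ℝ) : EReal) * negLog (C.detError W)

end OpenLoopCode

/-- The pair `(R, E)` is achieved, up to every `ε > 0`, by open-loop codes of arbitrarily large
block length. -/
def Achievable (W : S → X → stdSimplex ℝ (Y × Z)) (R E : ℝ) : Prop :=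
  ∀ ε : ℝ, 0 < ε → ∀ N : ℕ, ∃ n : ℕ, N < n ∧ ∃ C : OpenLoopCode S X Y Z n,
    C.commError W ≤ ε ∧ ((E - ε : ℝ) : EReal) ≤ C.detExponent W ∧ R - ε ≤ C.rate

/-- The open-loop region: closure of the set of achievable pairs of nonnegative reals. -/
def openLoopRegion (W : S → X → stdSimplex ℝ (Y × Z)) : Set (ℝ × ℝ) :=
  closure {p | 0 ≤ p.1 ∧ 0 ≤ p.2 ∧ Achievable W p.1 p.2}

end JointCommSensing

end

/-!
When the inputs are interchangeable for sensing, the laws of the sensing output under two states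
along any codeword are, up to a relabelling of the outputs, the `n`-fold powers of the laws at one
fixed input. State detection is then a test between independent samples whose difficulty does not
depend on the code, so that rate and exponent can be optimised separately and the region is a
rectangle.

For the exponent, the two error probabilities of a test between `p` and `q` add up to at least the
overlap `∑ min (p, q)`, and the maximum likelihood estimator errs with at most the sum of the
pairwise overlaps. The overlap of the `n`-fold powers decays with the Chernoff information: it is
at most `∑ p^l q^(1-l)` for each `l`; conversely, if `l` minimises this sum, the tilted law
proportional to `p^l q^(1-l)` has relative entropy at most the Chernoff information from both `p`
and `q`, and its typical words carry the required overlap.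

For the rate, Feinstein's greedy construction for the uniform mixture of the block channels gives
codes that work for every state. The weak converse uses the empirical law of all letters of all
codewords, which does not depend on the state, as the common input law.
-/

noncomputable section

namespace JointCommSensing

open Finset Filter Topology

section Sums

variable {A : Type*} [Fintype A]

theorem sum_filter_le_sum_filter {f : A → ℝ} (hf : ∀ a, 0 ≤ f a) {p q : A → Prop}
    [DecidablePred p] [DecidablePred q] (hpq : ∀ a, f a ≠ 0 → p a → q a) :
    ∑ a with p a, f a ≤ ∑ a with q a, f a := by
  rw [sum_filter, sum_filter]
  refine sum_le_sum fun a _ => ?_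
  rcases eq_or_ne (f a) 0 with h | h
  · simp [h]
  · by_cases hp : p a
    · simp [hp, hpq a h hp]
    · simp only [hp, if_false]
      split_ifs
      exacts [hf a, le_rfl]

theorem exists_le_sum_mul {p : A → ℝ} (hp : p ∈ stdSimplex ℝ A) (f : A → ℝ) :
    ∃ a, f a ≤ ∑ a', p a' * f a' := by
  have hA : (univ : Finset A).Nonempty := by
    rw [univ_nonempty_iff, ← not_isEmpty_iff]
    intro _
    simpa using hp.2
  obtain ⟨a, -, ha⟩ := exists_min_image univ f hA
  refine ⟨a, ?_⟩
  calc f a = ∑ a', p a' * f a := by rw [← sum_mul, hp.2, one_mul]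
    _ ≤ ∑ a', p a' * f a' :=
        sum_le_sum fun a' _ => mul_le_mul_of_nonneg_left (ha a' (mem_univ a')) (hp.1 a')

theorem eventually_mul_exp_le {a b : ℝ} (hab : a < b) (K : ℝ) :
    ∀ᶠ n : ℕ in atTop, K * Real.exp (n * a) ≤ Real.exp (n * b) := by
  have h := (tendsto_natCast_atTop_atTop (R := ℝ)).atTop_mul_const (sub_pos.2 hab)
  filter_upwards [(Real.tendsto_exp_atTop.comp h).eventually_ge_atTop K] with n hn
  calc K * Real.exp (n * a) ≤ Real.exp (n * (b - a)) * Real.exp (n * a) :=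
        mul_le_mul_of_nonneg_right hn (Real.exp_pos _).le
    _ = Real.exp (n * b) := by rw [← Real.exp_add]; ring_nf

end Sums

section ProductLaws

variable {ι A : Type*} [Fintype ι]

/-- The law of a word whose letters are independent, the `i`-th one having the law `p i`. -/
def prodLaw (p : ι → A → ℝ) (o : ι → A) : ℝ :=
  ∏ i, p i (o i)

theorem prodLaw_nonneg {p : ι → A → ℝ} (hp : ∀ i a, 0 ≤ p i a) (o : ι → A) : 0 ≤ prodLaw p o :=
  prod_nonneg fun i _ => hp i (o i)

theorem prodLaw_mul (p q : ι → A → ℝ) (o : ι → A) :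
    prodLaw (fun i a => p i a * q i a) o = prodLaw p o * prodLaw q o :=
  prod_mul_distrib

theorem log_prodLaw_sub_log_prodLaw {u v : ι → A → ℝ} (huv : ∀ i a, v i a = 0 → u i a = 0)
    {o : ι → A} (ho : prodLaw u o ≠ 0) :
    Real.log (prodLaw u o) - Real.log (prodLaw v o) =
      ∑ i, (Real.log (u i (o i)) - Real.log (v i (o i))) := by
  have hu (i : ι) : u i (o i) ≠ 0 := prod_ne_zero_iff.1 ho i (mem_univ i)
  rw [prodLaw, prodLaw, Real.log_prod fun i _ => hu i,
    Real.log_prod fun i _ h => hu i (huv i _ h), sum_sub_distrib]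

theorem prodLaw_eq_zero_of_prodLaw_eq_zero {u v : ι → A → ℝ}
    (huv : ∀ i a, v i a = 0 → u i a = 0) (o : ι → A) (ho : prodLaw v o = 0) : prodLaw u o = 0 := by
  obtain ⟨i, -, hi⟩ := prod_eq_zero_iff.1 ho
  exact prod_eq_zero (mem_univ i) (huv i _ hi)

variable [DecidableEq ι] [Fintype A]

theorem sum_prodLaw (p : ι → A → ℝ) : ∑ o, prodLaw p o = ∏ i, ∑ a, p i a := by
  simp only [prodLaw, prod_univ_sum, Fintype.piFinset_univ]

theorem prodLaw_mem_stdSimplex {p : ι → A → ℝ} (hp : ∀ i, p i ∈ stdSimplex ℝ A) :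
    prodLaw p ∈ stdSimplex ℝ (ι → A) :=
  ⟨prodLaw_nonneg fun i => (hp i).1, by simp [sum_prodLaw, (hp _).2]⟩

theorem sum_prodLaw_mul_apply {p : ι → A → ℝ} (hp : ∀ i, ∑ a, p i a = 1) (j : ι) (g : A → ℝ) :
    ∑ o, prodLaw p o * g (o j) = ∑ a, p j a * g a := by
  have h_weight (o : ι → A) : g (o j) = prodLaw (fun i a => if i = j then g a else 1) o := by
    simp [prodLaw]
  have h_factor (i : ι) :
      ∑ a, p i a * (if i = j then g a else 1) = if i = j then ∑ a, p i a * g a else 1 := by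
    split_ifs <;> simp [hp]
  simp only [h_weight, ← prodLaw_mul, sum_prodLaw, h_factor, prod_ite_eq', mem_univ, if_true]

end ProductLaws

section LawOfLargeNumbers

variable {A : Type*} [Fintype A]

theorem sum_prodLaw_le_pow_of_le_sum {p : A → ℝ} (hp : ∀ a, 0 ≤ p a) (g : A → ℝ) (m : ℝ) {t : ℝ}
    (ht : 0 ≤ t) (n : ℕ) :
    ∑ o : Fin n → A with n * m ≤ ∑ i, g (o i), prodLaw (fun _ => p) o ≤
      (∑ a, p a * Real.exp (t * (g a - m))) ^ n := by
  have h_exp (o : Fin n → A) :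
      prodLaw (fun (_ : Fin n) a => Real.exp (t * (g a - m))) o =
        Real.exp (t * (∑ i, g (o i) - n * m)) := by
    rw [prodLaw, ← Real.exp_sum, ← mul_sum, sum_sub_distrib, sum_const, card_univ,
      Fintype.card_fin, nsmul_eq_mul]
  calc ∑ o : Fin n → A with n * m ≤ ∑ i, g (o i), prodLaw (fun _ => p) o
      ≤ ∑ o : Fin n → A with n * m ≤ ∑ i, g (o i),
          prodLaw (fun _ => p) o * Real.exp (t * (∑ i, g (o i) - n * m)) := by
        refine sum_le_sum fun o ho => ?_
        have h_tail : n * m ≤ ∑ i, g (o i) := (mem_filter.1 ho).2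
        exact le_mul_of_one_le_right (prodLaw_nonneg (fun _ => hp) o)
          (Real.one_le_exp (mul_nonneg ht (sub_nonneg.2 h_tail)))
    _ ≤ ∑ o : Fin n → A, prodLaw (fun _ => p) o * Real.exp (t * (∑ i, g (o i) - n * m)) :=
        sum_le_univ_sum_of_nonneg fun o =>
          mul_nonneg (prodLaw_nonneg (fun _ => hp) o) (Real.exp_pos _).le
    _ = (∑ a, p a * Real.exp (t * (g a - m))) ^ n := by
        simp only [← h_exp, ← prodLaw_mul, sum_prodLaw, prod_const, card_univ, Fintype.card_fin]

theorem exists_sum_mul_exp_lt_one {p : A → ℝ} (hp : ∑ a, p a = 1) {g : A → ℝ} {m : ℝ}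
    (hm : ∑ a, p a * g a < m) :
    ∃ t > 0, ∑ a, p a * Real.exp (t * (g a - m)) < 1 := by
  have h_deriv : HasDerivAt (fun t : ℝ => ∑ a, p a * Real.exp (t * (g a - m)))
      (∑ a, p a * (g a - m)) 0 := by
    refine HasDerivAt.fun_sum fun a _ => HasDerivAt.const_mul _ ?_
    simpa using ((hasDerivAt_id (0 : ℝ)).mul_const (g a - m)).exp
  have h_neg : ∑ a, p a * (g a - m) < 0 := by
    simpa [mul_sub, ← sum_mul, hp] using hm
  obtain ⟨t, h_slope, ht : 0 < t⟩ := ((h_deriv.hasDerivWithinAt.limsup_slope_le'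
    (Set.self_notMem_Ioi (a := 0)) h_neg).and self_mem_nhdsWithin).exists
  refine ⟨t, ht, ?_⟩
  rw [slope_def_field, sub_zero, div_lt_iff₀ ht] at h_slope
  simpa [hp] using h_slope

theorem eventually_sum_prodLaw_le {p : A → ℝ} (hp : p ∈ stdSimplex ℝ A) {g : A → ℝ} {m : ℝ}
    (hm : ∑ a, p a * g a < m) {ε : ℝ} (hε : 0 < ε) :
    ∀ᶠ n : ℕ in atTop,
      ∑ o : Fin n → A with n * m ≤ ∑ i, g (o i), prodLaw (fun _ => p) o ≤ ε := by
  obtain ⟨t, ht, h_lt⟩ := exists_sum_mul_exp_lt_one hp.2 hm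
  have h_nonneg : 0 ≤ ∑ a, p a * Real.exp (t * (g a - m)) :=
    sum_nonneg fun a _ => mul_nonneg (hp.1 a) (Real.exp_pos _).le
  filter_upwards [(tendsto_pow_atTop_nhds_zero_of_lt_one h_nonneg h_lt).eventually_le_const hε]
    with n hn
  exact (sum_prodLaw_le_pow_of_le_sum hp.1 g m ht.le n).trans hn

end LawOfLargeNumbers

section RelativeEntropy

variable {A : Type*} [Fintype A]

/-- The relative entropy `D(u‖v)` in nats. Since `Real.log 0 = 0`, this is the divergence only if
`v a = 0` implies `u a = 0`. -/
def relEntropy (u v : A → ℝ) : ℝ :=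
  ∑ a, u a * (Real.log (u a) - Real.log (v a))

theorem mul_log_sub_mul_le_mul_log_sub_log {u v c : ℝ} (hu : 0 ≤ u) (hv : 0 ≤ v)
    (huv : v = 0 → u = 0) (hc : 0 < c) :
    u * Real.log c - c * v + u ≤ u * (Real.log u - Real.log v) := by
  rcases hu.eq_or_lt with rfl | hu
  · simpa using mul_nonneg hc.le hv
  have hv : 0 < v := hv.lt_of_ne fun h => hu.ne' (huv h.symm)
  have h_log := mul_le_mul_of_nonneg_left
    (Real.log_le_sub_one_of_pos (show 0 < c * v / u by positivity)) hu.le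
  rw [Real.log_div (by positivity) hu.ne', Real.log_mul hc.ne' hv.ne',
    mul_sub_one, mul_div_cancel₀ _ hu.ne'] at h_log
  linarith

theorem sum_mul_log_sub_le_relEntropy {u v : A → ℝ} (hu : u ∈ stdSimplex ℝ A) (hv : ∀ a, 0 ≤ v a)
    (hv1 : ∑ a, v a ≤ 1) (huv : ∀ a, v a = 0 → u a = 0) {c : ℝ} (hc : 0 < c) (D : A → Prop)
    [DecidablePred D] :
    (∑ a with D a, u a) * Real.log c - c * ∑ a with D a, v a ≤ relEntropy u v := by
  have h_in := sum_le_sum fun a (_ : a ∈ univ.filter D) =>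
    mul_log_sub_mul_le_mul_log_sub_log (hu.1 a) (hv a) (huv a) hc
  have h_out := sum_le_sum fun a (_ : a ∈ univ.filter (¬ D ·)) =>
    mul_log_sub_mul_le_mul_log_sub_log (hu.1 a) (hv a) (huv a) one_pos
  have hu_split := sum_filter_add_sum_filter_not univ D u
  have hv_split := sum_filter_add_sum_filter_not univ D v
  have h_split := sum_filter_add_sum_filter_not univ D
    fun a => u a * (Real.log (u a) - Real.log (v a))
  have hv_nonneg : 0 ≤ ∑ a with D a, v a := sum_nonneg fun a _ => hv a
  simp only [sum_add_distrib, sum_sub_distrib, ← sum_mul, ← mul_sum, Real.log_one, mul_zero,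
    one_mul, sum_const_zero] at h_in h_out
  rw [hu.2] at hu_split
  rw [relEntropy, ← h_split]
  linarith

theorem relEntropy_prodLaw {ι : Type*} [Fintype ι] [DecidableEq ι] {u v : ι → A → ℝ}
    (hu : ∀ i, ∑ a, u i a = 1) (huv : ∀ i a, v i a = 0 → u i a = 0) :
    relEntropy (prodLaw u) (prodLaw v) = ∑ i, relEntropy (u i) (v i) := by
  calc relEntropy (prodLaw u) (prodLaw v)
      = ∑ o, prodLaw u o * ∑ i, (Real.log (u i (o i)) - Real.log (v i (o i))) := by
        refine sum_congr rfl fun o _ => ?_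
        by_cases ho : prodLaw u o = 0
        · simp [ho]
        · rw [log_prodLaw_sub_log_prodLaw huv ho]
    _ = ∑ i, relEntropy (u i) (v i) := by
        simp only [mul_sum]
        rw [sum_comm]
        exact sum_congr rfl fun i _ =>
          sum_prodLaw_mul_apply hu i fun a => Real.log (u i a) - Real.log (v i a)

theorem eventually_sum_exp_mul_prodLaw_le {u v : A → ℝ} (hu : u ∈ stdSimplex ℝ A)
    (hv : ∀ a, 0 ≤ v a) (huv : ∀ a, v a = 0 → u a = 0) {c : ℝ} (hc : relEntropy u v < c) {ε : ℝ}
    (hε : 0 < ε) :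
    ∀ᶠ n : ℕ in atTop, ∑ o : Fin n → A with
      Real.exp (n * c) * prodLaw (fun _ => v) o ≤ prodLaw (fun _ => u) o,
        prodLaw (fun _ => u) o ≤ ε := by
  filter_upwards [eventually_sum_prodLaw_le hu hc hε] with n hn
  refine (sum_filter_le_sum_filter (prodLaw_nonneg fun _ => hu.1) fun o ho h => ?_).trans hn
  have hu_pos := (prodLaw_nonneg (fun _ => hu.1) o).lt_of_ne' ho
  have hv_pos := (prodLaw_nonneg (fun _ => hv) o).lt_of_ne'
    (mt (prodLaw_eq_zero_of_prodLaw_eq_zero (fun _ => huv) o) ho)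
  rw [← log_prodLaw_sub_log_prodLaw (fun _ => huv) ho, le_sub_iff_add_le,
    Real.le_log_iff_exp_le hu_pos, Real.exp_add, Real.exp_log hv_pos]
  exact h

theorem eventually_sum_prodLaw_le_exp_mul {u v : A → ℝ} (hu : u ∈ stdSimplex ℝ A)
    (hv : ∀ a, 0 ≤ v a) (huv : ∀ a, v a = 0 → u a = 0) {c : ℝ} (hc : c < relEntropy u v) {ε : ℝ}
    (hε : 0 < ε) :
    ∀ᶠ n : ℕ in atTop, ∑ o : Fin n → A with
      prodLaw (fun _ => u) o ≤ Real.exp (n * c) * prodLaw (fun _ => v) o,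
        prodLaw (fun _ => u) o ≤ ε := by
  have h_mean : ∑ a, u a * -(Real.log (u a) - Real.log (v a)) < -c := by
    simpa only [mul_neg, sum_neg_distrib, neg_lt_neg_iff, relEntropy] using hc
  filter_upwards [eventually_sum_prodLaw_le hu h_mean hε] with n hn
  refine (sum_filter_le_sum_filter (prodLaw_nonneg fun _ => hu.1) fun o ho h => ?_).trans hn
  have hu_pos := (prodLaw_nonneg (fun _ => hu.1) o).lt_of_ne' ho
  have hv_pos := (prodLaw_nonneg (fun _ => hv) o).lt_of_ne'
    (mt (prodLaw_eq_zero_of_prodLaw_eq_zero (fun _ => huv) o) ho)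
  rw [sum_neg_distrib, ← log_prodLaw_sub_log_prodLaw (fun _ => huv) ho, mul_neg, neg_le_neg_iff,
    sub_le_iff_le_add, Real.log_le_iff_le_exp hu_pos, Real.exp_add, Real.exp_log hv_pos]
  exact h

end RelativeEntropy

section MutualInformation

variable {X Y : Type*} [Fintype X]

/-- The joint law of input and output for the input law `P` and the channel `U`. -/
def jointLaw (P : X → ℝ) (U : X → Y → ℝ) (c : X × Y) : ℝ :=
  P c.1 * U c.1 c.2

/-- The law of the output for the input law `P` and the channel `U`. -/
def outputLaw (P : X → ℝ) (U : X → Y → ℝ) (y : Y) : ℝ :=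
  ∑ x, P x * U x y

theorem outputLaw_nonneg {P : X → ℝ} (hP : ∀ x, 0 ≤ P x) {U : X → Y → ℝ} (hU : ∀ x y, 0 ≤ U x y)
    (y : Y) : 0 ≤ outputLaw P U y :=
  sum_nonneg fun x _ => mul_nonneg (hP x) (hU x y)

theorem eq_zero_of_outputLaw_eq_zero {P : X → ℝ} (hP : ∀ x, 0 ≤ P x) {U : X → Y → ℝ}
    (hU : ∀ x y, 0 ≤ U x y) {x : X} (hx : P x ≠ 0) (y : Y) (hy : outputLaw P U y = 0) :
    U x y = 0 := by
  have h := (sum_eq_zero_iff_of_nonneg fun x _ => mul_nonneg (hP x) (hU x y)).1 hy x (mem_univ x)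
  exact (mul_eq_zero.1 h).resolve_left hx

theorem sum_outputLaw (P : X → ℝ) (U : X → Y → ℝ) (t : Finset Y) :
    ∑ y ∈ t, outputLaw P U y = ∑ x, P x * ∑ y ∈ t, U x y := by
  simp only [outputLaw, mul_sum]
  exact sum_comm

variable [Fintype Y]

theorem sum_jointLaw_filter (P : X → ℝ) (U : X → Y → ℝ) (D : X × Y → Prop) [DecidablePred D] :
    ∑ c with D c, jointLaw P U c = ∑ x, P x * ∑ y with D (x, y), U x y := by
  simp only [sum_filter, Fintype.sum_prod_type, mul_sum, mul_ite, mul_zero, jointLaw]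

theorem sum_jointLaw_filter_snd (P : X → ℝ) (U : X → Y → ℝ) (D : Y → Prop) [DecidablePred D] :
    ∑ c with D c.2, jointLaw P U c = ∑ y with D y, outputLaw P U y :=
  (sum_jointLaw_filter P U fun c => D c.2).trans (sum_outputLaw P U (univ.filter D)).symm

theorem jointLaw_mem_stdSimplex {P : X → ℝ} (hP : P ∈ stdSimplex ℝ X) {U : X → Y → ℝ}
    (hU : ∀ x, U x ∈ stdSimplex ℝ Y) : jointLaw P U ∈ stdSimplex ℝ (X × Y) :=
  ⟨fun c => mul_nonneg (hP.1 c.1) ((hU c.1).1 c.2), by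
    simp only [jointLaw, Fintype.sum_prod_type, ← mul_sum, (hU _).2, mul_one, hP.2]⟩

theorem outputLaw_mem_stdSimplex {P : X → ℝ} (hP : P ∈ stdSimplex ℝ X) {U : X → Y → ℝ}
    (hU : ∀ x, U x ∈ stdSimplex ℝ Y) : outputLaw P U ∈ stdSimplex ℝ Y :=
  ⟨outputLaw_nonneg hP.1 fun x => (hU x).1, by
    simp only [sum_outputLaw, (hU _).2, mul_one, hP.2]⟩

theorem mutualInfo_eq_sum_mul_relEntropy (P : stdSimplex ℝ X) (U : X → Y → ℝ) :
    mutualInfo P U = ∑ x, P x * relEntropy (U x) (outputLaw P U) := by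
  have h_out : ∑ x, ∑ y, P x * (U x y * Real.log (outputLaw P U y)) =
      ∑ y, outputLaw P U y * Real.log (outputLaw P U y) := by
    rw [sum_comm]
    simp only [outputLaw, sum_mul, mul_assoc]
  simp only [mutualInfo, entropy, relEntropy, Real.negMulLog, mul_sub, sum_sub_distrib, mul_sum,
    h_out, neg_mul, mul_neg, sum_neg_distrib]
  simp only [outputLaw]
  ring

theorem mutualInfo_eq_relEntropy_jointLaw (P : stdSimplex ℝ X) {U : X → Y → ℝ}
    (hU : ∀ x y, 0 ≤ U x y) :
    mutualInfo P U = relEntropy (jointLaw P U) (fun c => P c.1 * outputLaw P U c.2) := by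
  simp only [mutualInfo_eq_sum_mul_relEntropy, relEntropy, Fintype.sum_prod_type, mul_sum, jointLaw]
  refine sum_congr rfl fun x _ => sum_congr rfl fun y _ => ?_
  by_cases hx : P x = 0
  · simp [hx]
  by_cases hy : U x y = 0
  · simp [hy]
  have h_out : outputLaw P U y ≠ 0 := mt (eq_zero_of_outputLaw_eq_zero P.2.1 hU hx y) hy
  rw [Real.log_mul hx hy, Real.log_mul hx h_out]
  ring

end MutualInformation

section Coding

/-- The union of the first `k` decoding regions `T a` in the greedy construction of a code, when
`next u` is the codeword selected once the outputs in `u` are used up. -/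
def greedyUsed {A B : Type*} [DecidableEq B] (T : A → Finset B) (next : Finset B → A) :
    ℕ → Finset B
  | 0 => ∅
  | k + 1 => greedyUsed T next k ∪ T (next (greedyUsed T next k))

theorem mem_greedyUsed {A B : Type*} [DecidableEq B] {T : A → Finset B} {next : Finset B → A}
    {k : ℕ} {b : B} : b ∈ greedyUsed T next k ↔ ∃ j < k, b ∈ T (next (greedyUsed T next j)) := by
  induction k with
  | zero => simp [greedyUsed]
  | succ k ih => simp only [greedyUsed, mem_union, ih, Nat.exists_lt_succ_right]

theorem sum_greedyUsed_le {A B : Type*} [DecidableEq B] {T : A → Finset B} {f : B → ℝ}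
    (hf : ∀ b, 0 ≤ f b) {K : ℝ} (hT : ∀ a, ∑ b ∈ T a, f b ≤ K) (next : Finset B → A) (k : ℕ) :
    ∑ b ∈ greedyUsed T next k, f b ≤ k * K := by
  induction k with
  | zero => simp [greedyUsed]
  | succ k ih =>
    have h_inter : 0 ≤ ∑ b ∈ greedyUsed T next k ∩ T (next (greedyUsed T next k)), f b :=
      sum_nonneg fun b _ => hf b
    have h_union := sum_union_inter (s₁ := greedyUsed T next k)
      (s₂ := T (next (greedyUsed T next k))) (f := f)
    rw [greedyUsed]
    push_cast
    linarith [hT (next (greedyUsed T next k))]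

/-- The decoder returns the first codeword passing the test. -/
theorem exists_decoder {A B : Type*} (T : A → Finset B) (enc : ℕ → A) {M : ℕ} (hM : 0 < M) :
    ∃ dec : B → Fin M, ∀ (w : Fin M) b,
      b ∈ T (enc w) → (∀ j < w.val, b ∉ T (enc j)) → dec b = w := by
  have h_first (b : B) : ∃ v : Fin M, ∀ w : Fin M, b ∈ T (enc w) →
      (∀ j < w.val, b ∉ T (enc j)) → v = w := by
    by_cases hb : ∃ v : Fin M, b ∈ T (enc v) ∧ ∀ j < v.val, b ∉ T (enc j)
    · obtain ⟨v, hv, hv_first⟩ := hb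
      exact ⟨v, fun w hw hw_first => le_antisymm (not_lt.1 fun h => hv_first w h hw)
        (not_lt.1 fun h => hw_first v h hv)⟩
    · exact ⟨⟨0, hM⟩, fun w hw hw_first => (hb ⟨w, hw, hw_first⟩).elim⟩
  choose dec hdec using h_first
  exact ⟨dec, fun w b => hdec b w⟩

variable {A B : Type*} [Fintype A] [Fintype B]

/-- The selection step of Feinstein's lemma: the bound holds on average over the input law. -/
theorem exists_codeword_sum_le [DecidableEq B] {p : A → ℝ} (hp : p ∈ stdSimplex ℝ A)
    {V : A → B → ℝ} (hV : ∀ a b, 0 ≤ V a b) (θ : ℝ) (u : Finset B) :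
    ∃ a, ∑ b with θ * outputLaw p V b ≤ V a b → b ∈ u, V a b ≤
      ∑ c with V c.1 c.2 < θ * outputLaw p V c.2, jointLaw p V c +
        ∑ b ∈ u, outputLaw p V b := by
  obtain ⟨a, ha⟩ := exists_le_sum_mul hp
    fun a => ∑ b with θ * outputLaw p V b ≤ V a b → b ∈ u, V a b
  refine ⟨a, ha.trans ?_⟩
  rw [sum_jointLaw_filter, sum_outputLaw, ← sum_add_distrib]
  refine sum_le_sum fun a _ => ?_
  rw [← mul_add, ← sum_union_inter]
  refine mul_le_mul_of_nonneg_left ?_ (hp.1 a)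
  refine le_add_of_le_of_nonneg (sum_le_sum_of_subset_of_nonneg (fun b hb => ?_)
    fun b _ _ => hV a b) (sum_nonneg fun b _ => hV a b)
  simp only [mem_union, mem_filter, mem_univ, true_and] at hb ⊢
  rcases lt_or_ge (V a b) (θ * outputLaw p V b) with h | h
  exacts [.inl h, .inr (hb h)]

/-- Feinstein's lemma: the codewords are selected greedily, each one being judged by the outputs
that the decoding regions of the earlier ones have left over. -/
theorem exists_code_sum_le {p : A → ℝ} (hp : p ∈ stdSimplex ℝ A) {V : A → B → ℝ}
    (hV : ∀ a, V a ∈ stdSimplex ℝ B) {θ : ℝ} (hθ : 0 < θ) {M : ℕ} (hM : 0 < M) :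
    ∃ (enc : Fin M → A) (dec : B → Fin M), ∀ w, ∑ b with dec b ≠ w, V (enc w) b ≤
      ∑ c with V c.1 c.2 < θ * outputLaw p V c.2, jointLaw p V c + w / θ := by
  classical
  let T (a : A) : Finset B := {b | θ * outputLaw p V b ≤ V a b}
  have hT (a : A) : ∑ b ∈ T a, outputLaw p V b ≤ 1 / θ := by
    rw [le_div_iff₀' hθ, mul_sum, ← (hV a).2]
    exact (sum_le_sum fun b hb => (mem_filter.1 hb).2).trans (sum_le_univ_sum_of_nonneg (hV a).1)
  choose next h_next using exists_codeword_sum_le hp (fun a => (hV a).1) θ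
  obtain ⟨dec, h_dec⟩ := exists_decoder T (fun k => next (greedyUsed T next k)) hM
  refine ⟨fun w => next (greedyUsed T next w), dec, fun w => ?_⟩
  have h_used := sum_greedyUsed_le (outputLaw_nonneg hp.1 fun a => (hV a).1) hT next w
  rw [mul_one_div] at h_used
  refine le_trans ?_ ((h_next (greedyUsed T next w)).trans (add_le_add_right h_used _))
  refine sum_filter_le_sum_filter (hV _).1 fun b _ hb h_pass => ?_
  by_contra h_unused
  exact hb (h_dec w b (mem_filter.2 ⟨mem_univ b, h_pass⟩) fun j hj h =>
    h_unused (mem_greedyUsed.2 ⟨j, hj, h⟩))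

/-- Change of the reference law in an information density: where `outputLaw p U` exceeds
`t / r * Q`, the density with respect to `Q` bounds the one with respect to `outputLaw p U`, and the
other outputs have probability at most `t / r`. -/
theorem sum_jointLaw_lt_mul_le {p : A → ℝ} (hp : ∀ a, 0 ≤ p a) {U : A → B → ℝ}
    (hU : ∀ a b, 0 ≤ U a b) {Q : B → ℝ} (hQ : ∀ b, 0 ≤ Q b) (hQ1 : ∑ b, Q b ≤ 1) {r t : ℝ}
    (hr : 0 < r) (ht : 0 ≤ t) :
    ∑ c with U c.1 c.2 < t * Q c.2, jointLaw p U c ≤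
      ∑ c with jointLaw p U c ≤ r * (p c.1 * outputLaw p U c.2), jointLaw p U c + t / r := by
  classical
  have h_joint (c : A × B) : 0 ≤ jointLaw p U c := mul_nonneg (hp c.1) (hU c.1 c.2)
  have h_low : ∑ c with outputLaw p U c.2 ≤ t / r * Q c.2, jointLaw p U c ≤ t / r := by
    calc ∑ c with outputLaw p U c.2 ≤ t / r * Q c.2, jointLaw p U c
        = ∑ b with outputLaw p U b ≤ t / r * Q b, outputLaw p U b :=
          sum_jointLaw_filter_snd p U fun b => outputLaw p U b ≤ t / r * Q b
      _ ≤ ∑ b with outputLaw p U b ≤ t / r * Q b, t / r * Q b :=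
          sum_le_sum fun b hb => (mem_filter.1 hb).2
      _ ≤ ∑ b, t / r * Q b := sum_le_univ_sum_of_nonneg fun b => by have := hQ b; positivity
      _ ≤ t / r := by rw [← mul_sum]; exact mul_le_of_le_one_right (by positivity) hQ1
  refine le_trans ?_ (add_le_add_right h_low _)
  rw [← sum_union_inter]
  refine le_add_of_le_of_nonneg (sum_le_sum_of_subset_of_nonneg (fun c hc => ?_)
    fun c _ _ => h_joint c) (sum_nonneg fun c _ => h_joint c)
  simp only [mem_union, mem_filter, mem_univ, true_and] at hc ⊢
  rcases le_or_gt (outputLaw p U c.2) (t / r * Q c.2) with h | h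
  · exact .inr h
  · refine .inl ?_
    have h_density : U c.1 c.2 ≤ r * outputLaw p U c.2 := by
      rw [div_mul_eq_mul_div, div_lt_iff₀' hr] at h
      exact (hc.trans h).le
    calc jointLaw p U c ≤ p c.1 * (r * outputLaw p U c.2) :=
          mul_le_mul_of_nonneg_left h_density (hp c.1)
      _ = r * (p c.1 * outputLaw p U c.2) := by ring

/-- The uniform mixture of the channels `U s`. -/
def averageChannel {S A B : Type*} [Fintype S] (U : S → A → B → ℝ) (a : A) (b : B) : ℝ :=
  (Fintype.card S : ℝ)⁻¹ * ∑ s, U s a b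

theorem le_card_mul_averageChannel {S A B : Type*} [Fintype S] {U : S → A → B → ℝ}
    (hU : ∀ s a b, 0 ≤ U s a b) (s : S) (a : A) (b : B) :
    U s a b ≤ Fintype.card S * averageChannel U a b := by
  have hS : (Fintype.card S : ℝ) ≠ 0 := Nat.cast_ne_zero.2 (card_ne_zero_of_mem (mem_univ s))
  rw [averageChannel, mul_inv_cancel_left₀ hS]
  exact single_le_sum (f := fun s => U s a b) (fun s _ => hU s a b) (mem_univ s)

theorem averageChannel_mem_stdSimplex {S A B : Type*} [Fintype S] [Nonempty S] [Fintype B]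
    {U : S → A → B → ℝ} (hU : ∀ s a, U s a ∈ stdSimplex ℝ B) (a : A) :
    averageChannel U a ∈ stdSimplex ℝ B := by
  refine ⟨fun b => mul_nonneg (by positivity) (sum_nonneg fun s _ => (hU s a).1 b), ?_⟩
  simp only [averageChannel, ← mul_sum]
  rw [sum_comm]
  simp [(hU _ a).2]

theorem sum_jointLaw_averageChannel_le {S : Type*} [Fintype S] [Nonempty S] (p : A → ℝ)
    (U : S → A → B → ℝ) (D : A × B → Prop) [DecidablePred D] {η : ℝ}
    (hη : ∀ s, ∑ c with D c, jointLaw p (U s) c ≤ η) :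
    ∑ c with D c, jointLaw p (averageChannel U) c ≤ η := by
  have h_joint (c : A × B) : jointLaw p (averageChannel U) c =
      (Fintype.card S : ℝ)⁻¹ * ∑ s, jointLaw p (U s) c := by
    simp only [jointLaw, averageChannel, ← mul_sum, mul_left_comm]
  simp only [h_joint, ← mul_sum]
  rw [sum_comm, inv_mul_le_iff₀ (Nat.cast_pos.2 Fintype.card_pos)]
  exact (sum_le_sum fun s _ => hη s).trans_eq (by simp)

/-- A code for the uniform mixture of the channels works for each of them, since the mixture
dominates each channel up to the factor `Fintype.card S`. -/
theorem exists_compound_code_sum_le {S : Type*} [Fintype S] [Nonempty S] {p : A → ℝ}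
    (hp : p ∈ stdSimplex ℝ A) {U : S → A → B → ℝ} (hU : ∀ s a, U s a ∈ stdSimplex ℝ B)
    {r θ η : ℝ} (hr : 0 < r) (hθ : 0 < θ)
    (hη : ∀ s, ∑ c with jointLaw p (U s) c ≤ r * (p c.1 * outputLaw p (U s) c.2),
      jointLaw p (U s) c ≤ η) {M : ℕ} (hM : 0 < M) :
    ∃ (enc : Fin M → A) (dec : B → Fin M), ∀ s w, ∑ b with dec b ≠ w, U s (enc w) b ≤
      Fintype.card S * (η + Fintype.card S * θ / r + w / θ) := by
  set K : ℝ := (Fintype.card S : ℝ)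
  have hK : 0 < K := Nat.cast_pos.2 Fintype.card_pos
  have h_le := le_card_mul_averageChannel fun s a => (hU s a).1
  have hV := averageChannel_mem_stdSimplex hU
  have hQ := outputLaw_mem_stdSimplex hp hV
  have h_outage (s : S) : ∑ c with averageChannel U c.1 c.2 <
      θ * outputLaw p (averageChannel U) c.2, jointLaw p (U s) c ≤ η + K * θ / r := by
    refine le_trans ?_ ((sum_jointLaw_lt_mul_le hp.1 (fun a => (hU s a).1) hQ.1 hQ.2.le hr
      (mul_pos hK hθ).le).trans (add_le_add_left (hη s) _))
    refine sum_filter_le_sum_filter (jointLaw_mem_stdSimplex hp (hU s)).1 fun c _ hc => ?_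
    rw [mul_assoc]
    exact (h_le s c.1 c.2).trans_lt (mul_lt_mul_of_pos_left hc hK)
  obtain ⟨enc, dec, h_code⟩ := exists_code_sum_le hp hV hθ hM
  refine ⟨enc, dec, fun s w => ?_⟩
  calc ∑ b with dec b ≠ w, U s (enc w) b
      ≤ ∑ b with dec b ≠ w, K * averageChannel U (enc w) b :=
        sum_le_sum fun b _ => h_le s (enc w) b
    _ ≤ K * (η + K * θ / r + w / θ) := by
        rw [← mul_sum]
        exact mul_le_mul_of_nonneg_left ((h_code w).trans
          (add_le_add_left (sum_jointLaw_averageChannel_le p U _ h_outage) _)) hK.le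

end Coding

section BlockCoding

variable {X Y : Type*} {n : ℕ}

/-- The memoryless extension of the channel `U` to words of length `n`. -/
def blockChannel (U : X → Y → ℝ) (x : Fin n → X) : (Fin n → Y) → ℝ :=
  prodLaw fun i => U (x i)

theorem jointLaw_blockChannel (P : X → ℝ) (U : X → Y → ℝ) (x : Fin n → X) (y : Fin n → Y) :
    jointLaw (prodLaw fun _ => P) (blockChannel U) (x, y) =
      prodLaw (fun _ => jointLaw P U) fun i => (x i, y i) := by
  simp only [jointLaw, blockChannel, prodLaw, prod_mul_distrib]

theorem outputLaw_blockChannel [Fintype X] (P : X → ℝ) (U : X → Y → ℝ) (y : Fin n → Y) :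
    outputLaw (prodLaw fun _ => P) (blockChannel U) y = prodLaw (fun _ => outputLaw P U) y := by
  simp only [outputLaw, blockChannel, prodLaw, ← prod_mul_distrib]
  exact sum_prodLaw fun i x => P x * U x (y i)

theorem blockChannel_mem_stdSimplex [Fintype Y] {U : X → Y → ℝ} (hU : ∀ x, U x ∈ stdSimplex ℝ Y)
    (x : Fin n → X) : blockChannel U x ∈ stdSimplex ℝ (Fin n → Y) :=
  prodLaw_mem_stdSimplex fun i => hU (x i)

variable [Fintype X] [Fintype Y]

theorem eventually_sum_jointLaw_blockChannel_le (P : stdSimplex ℝ X) {U : X → Y → ℝ}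
    (hU : ∀ x, U x ∈ stdSimplex ℝ Y) {c : ℝ} (hc : c < mutualInfo P U) {η : ℝ} (hη : 0 < η) :
    ∀ᶠ n : ℕ in atTop, ∑ o : (Fin n → X) × (Fin n → Y) with
      jointLaw (prodLaw fun _ => P) (blockChannel U) o ≤
        Real.exp (n * c) * (prodLaw (fun _ => P) o.1 *
          outputLaw (prodLaw fun _ => P) (blockChannel U) o.2),
      jointLaw (prodLaw fun _ => P) (blockChannel U) o ≤ η := by
  have hU_nonneg := fun x => (hU x).1
  rw [mutualInfo_eq_relEntropy_jointLaw P hU_nonneg] at hc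
  have h_abs : ∀ a : X × Y, P a.1 * outputLaw P U a.2 = 0 → jointLaw P U a = 0 := by
    intro a ha
    by_cases hx : P a.1 = 0
    · rw [jointLaw, hx, zero_mul]
    · rw [jointLaw, eq_zero_of_outputLaw_eq_zero P.2.1 hU_nonneg hx a.2
        ((mul_eq_zero.1 ha).resolve_left hx), mul_zero]
  filter_upwards [eventually_sum_prodLaw_le_exp_mul (jointLaw_mem_stdSimplex P.2 hU)
    (fun a => mul_nonneg (P.2.1 a.1) (outputLaw_nonneg P.2.1 hU_nonneg a.2)) h_abs hc hη] with n hn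
  convert hn using 1
  simp only [sum_filter]
  rw [← Equiv.sum_comp (Equiv.arrowProdEquivProdArrow (Fin n) (fun _ => X) fun _ => Y)]
  refine sum_congr rfl fun o _ => ?_
  simp only [Equiv.arrowProdEquivProdArrow_apply, jointLaw_blockChannel, outputLaw_blockChannel]
  simp only [prodLaw, prod_mul_distrib]
  rfl

theorem eventually_exists_block_code {S : Type*} [Finite S] [Nonempty S] (P : stdSimplex ℝ X)
    {U : S → X → Y → ℝ} (hU : ∀ s x, U s x ∈ stdSimplex ℝ Y) {R I : ℝ} (hRI : R < I)
    (hI : ∀ s, I ≤ mutualInfo P (U s)) {ε : ℝ} (hε : 0 < ε) :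
    ∀ᶠ n : ℕ in atTop, ∃ (enc : Fin ⌈Real.exp (n * R)⌉₊ → Fin n → X)
      (dec : (Fin n → Y) → Fin ⌈Real.exp (n * R)⌉₊),
      ∀ s w, ∑ y with dec y ≠ w, blockChannel (U s) (enc w) y ≤ ε := by
  have := Fintype.ofFinite S
  obtain ⟨b, hRb, hbI⟩ := exists_between hRI
  obtain ⟨c, hbc, hcI⟩ := exists_between hbI
  set K : ℝ := (Fintype.card S : ℝ)
  have hK : 0 < K := Nat.cast_pos.2 Fintype.card_pos
  filter_upwards [eventually_all.2 fun s => eventually_sum_jointLaw_blockChannel_le P (hU s)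
    (hcI.trans_le (hI s)) (show 0 < ε / (3 * K) by positivity),
    eventually_mul_exp_le hbc (3 * K * K / ε), eventually_mul_exp_le hRb (3 * K / ε)]
    with n h_outage h_θ h_w
  obtain ⟨enc, dec, h_code⟩ := exists_compound_code_sum_le
    (prodLaw_mem_stdSimplex fun _ => P.2) (fun s => blockChannel_mem_stdSimplex (hU s))
    (Real.exp_pos (n * c)) (Real.exp_pos (n * b)) h_outage
    (Nat.ceil_pos.2 (Real.exp_pos (n * R)))
  refine ⟨enc, dec, fun s w => (h_code s w).trans ?_⟩
  have hw : (w : ℝ) ≤ Real.exp (n * R) := (Nat.lt_ceil.1 w.2).le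
  have h_θ' : K * Real.exp (n * b) / Real.exp (n * c) ≤ ε / (3 * K) := by
    rw [div_le_div_iff₀ (Real.exp_pos _) (by positivity)]
    rw [div_mul_eq_mul_div, div_le_iff₀ hε] at h_θ
    linarith
  have h_w' : w / Real.exp (n * b) ≤ ε / (3 * K) := by
    rw [div_le_div_iff₀ (Real.exp_pos _) (by positivity)]
    rw [div_mul_eq_mul_div, div_le_iff₀ hε] at h_w
    nlinarith
  calc K * (ε / (3 * K) + K * Real.exp (n * b) / Real.exp (n * c) + w / Real.exp (n * b))
      ≤ K * (ε / (3 * K) + ε / (3 * K) + ε / (3 * K)) := by gcongr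
    _ = ε := by field_simp; ring

end BlockCoding

section WeakConverse

/-- The empirical law of a finite family of letters. -/
def empiricalLaw {κ X : Type*} [Fintype κ] [Nonempty κ] [Fintype X] (f : κ → X) : stdSimplex ℝ X :=
  stdSimplex.map f stdSimplex.barycenter

theorem empiricalLaw_apply {κ X : Type*} [Fintype κ] [Nonempty κ] [Fintype X] [DecidableEq X]
    (f : κ → X) (x : X) : empiricalLaw f x = ∑ k with f k = x, (Fintype.card κ : ℝ)⁻¹ := by
  rw [empiricalLaw, stdSimplex.map_coe, FunOnFinite.linearMap_apply_apply]
  exact sum_congr rfl fun k _ => stdSimplex.barycenter_apply k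

theorem card_mul_sum_empiricalLaw_mul {κ X : Type*} [Fintype κ] [Nonempty κ] [Fintype X] (f : κ → X)
    (F : X → ℝ) : Fintype.card κ * ∑ x, empiricalLaw f x * F x = ∑ k, F (f k) := by
  classical
  have hκ : (Fintype.card κ : ℝ) ≠ 0 := Nat.cast_ne_zero.2 Fintype.card_ne_zero
  simp only [empiricalLaw_apply, sum_const, nsmul_eq_mul, mul_sum]
  rw [← sum_fiberwise univ f]
  refine sum_congr rfl fun x _ => ?_
  rw [sum_congr rfl fun k hk => by rw [(mem_filter.1 hk).2], sum_const, nsmul_eq_mul]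
  field_simp

theorem empiricalLaw_apply_pos {κ X : Type*} [Fintype κ] [Nonempty κ] [Fintype X] (f : κ → X)
    (k : κ) : 0 < empiricalLaw f (f k) := by
  classical
  rw [empiricalLaw_apply]
  exact sum_pos (fun _ _ => inv_pos.2 (Nat.cast_pos.2 Fintype.card_pos))
    ⟨k, mem_filter.2 ⟨mem_univ k, rfl⟩⟩

theorem card_mul_log_card_sub_one_le_sum_relEntropy {κ B : Type*} [Fintype κ] [Nonempty κ]
    [DecidableEq κ] [Fintype B] {V : κ → B → ℝ} (hV : ∀ w, V w ∈ stdSimplex ℝ B) {Q : B → ℝ}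
    (hQ : Q ∈ stdSimplex ℝ B) (hVQ : ∀ w b, Q b = 0 → V w b = 0) (dec : B → κ) {ε : ℝ}
    (h_err : ∀ w, ∑ b with dec b ≠ w, V w b ≤ ε) :
    Fintype.card κ * ((1 - ε) * Real.log (Fintype.card κ) - 1) ≤ ∑ w, relEntropy (V w) Q := by
  set K : ℝ := (Fintype.card κ : ℝ)
  have hK : 0 < K := Nat.cast_pos.2 Fintype.card_pos
  have h_message : ∀ w, (1 - ε) * Real.log K - K * ∑ b with dec b = w, Q b ≤
      relEntropy (V w) Q := by
    intro w
    refine le_trans ?_ (sum_mul_log_sub_le_relEntropy (hV w) hQ.1 hQ.2.le (hVQ w)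
      hK fun b => dec b = w)
    have h_split := (sum_filter_add_sum_filter_not univ (dec · = w) (V w)).trans (hV w).2
    gcongr
    linarith [h_err w]
  calc K * ((1 - ε) * Real.log K - 1)
      = ∑ w, ((1 - ε) * Real.log K - K * ∑ b with dec b = w, Q b) := by
        rw [sum_sub_distrib, ← mul_sum (f := fun w => ∑ b with dec b = w, Q b), sum_fiberwise,
          hQ.2, sum_const, card_univ, nsmul_eq_mul]
        ring
    _ ≤ ∑ w, relEntropy (V w) Q := sum_le_sum fun w _ => h_message w

theorem log_card_le_mul_mutualInfo {κ X Y : Type*} [Fintype κ] [Nonempty κ] [DecidableEq κ]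
    [Fintype X] [Fintype Y] {n : ℕ} [NeZero n] {U : X → Y → ℝ} (hU : ∀ x, U x ∈ stdSimplex ℝ Y)
    (enc : κ → Fin n → X) (dec : (Fin n → Y) → κ) {ε : ℝ}
    (h_err : ∀ w, ∑ y with dec y ≠ w, blockChannel U (enc w) y ≤ ε) :
    (1 - ε) * Real.log (Fintype.card κ) - 1 ≤
      n * mutualInfo (empiricalLaw fun k : κ × Fin n => enc k.1 k.2) U := by
  set P := empiricalLaw fun k : κ × Fin n => enc k.1 k.2
  have h_abs : ∀ w i y, outputLaw P U y = 0 → U (enc w i) y = 0 := fun w i =>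
    eq_zero_of_outputLaw_eq_zero P.2.1 (fun x => (hU x).1)
      (empiricalLaw_apply_pos (fun k : κ × Fin n => enc k.1 k.2) (w, i)).ne'
  have h_code := card_mul_log_card_sub_one_le_sum_relEntropy
    (fun w => blockChannel_mem_stdSimplex hU (enc w))
    (prodLaw_mem_stdSimplex fun _ : Fin n => outputLaw_mem_stdSimplex P.2 hU)
    (fun w => prodLaw_eq_zero_of_prodLaw_eq_zero (h_abs w)) dec h_err
  have h_letters : ∑ w, relEntropy (blockChannel U (enc w)) (prodLaw fun _ => outputLaw P U) =
      Fintype.card κ * (n * mutualInfo P U) := by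
    have h_card : (Fintype.card κ * n : ℝ) = Fintype.card (κ × Fin n) := by simp
    rw [mutualInfo_eq_sum_mul_relEntropy, ← mul_assoc, h_card, card_mul_sum_empiricalLaw_mul,
      Fintype.sum_prod_type]
    exact sum_congr rfl fun w _ => relEntropy_prodLaw (fun i => (hU (enc w i)).2) (h_abs w)
  exact le_of_mul_le_mul_left (h_code.trans_eq h_letters) (Nat.cast_pos.2 Fintype.card_pos)

end WeakConverse

section NegLog

theorem negLog_of_nonpos {t : ℝ} (ht : t ≤ 0) : negLog t = ⊤ := by
  simp [negLog, ENNReal.ofReal_of_nonpos ht]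

theorem negLog_of_pos {t : ℝ} (ht : 0 < t) : negLog t = ((-Real.log t : ℝ) : EReal) := by
  rw [negLog, ENNReal.log_ofReal_of_pos ht, EReal.coe_neg]

theorem coe_le_negLog_iff {a t : ℝ} : (a : EReal) ≤ negLog t ↔ t ≤ Real.exp (-a) := by
  rcases le_or_gt t 0 with ht | ht
  · simp only [negLog_of_nonpos ht, le_top, ht.trans (Real.exp_pos _).le]
  · rw [negLog_of_pos ht, EReal.coe_le_coe_iff, ← Real.log_le_iff_le_exp ht, le_neg]

theorem negLog_le_coe_iff {a t : ℝ} : negLog t ≤ (a : EReal) ↔ Real.exp (-a) ≤ t := by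
  rcases le_or_gt t 0 with ht | ht
  · simp only [negLog_of_nonpos ht, top_le_iff, EReal.coe_ne_top,
      (ht.trans_lt (Real.exp_pos _)).not_ge]
  · rw [negLog_of_pos ht, EReal.coe_le_coe_iff, ← Real.le_log_iff_exp_le ht, neg_le]

theorem coe_le_mul_negLog_iff {b : ℝ} (hb : 0 < b) {a t : ℝ} :
    (a : EReal) ≤ (b : EReal) * negLog t ↔ t ≤ Real.exp (-(a / b)) := by
  rcases le_or_gt t 0 with ht | ht
  · simp only [negLog_of_nonpos ht, EReal.coe_mul_top_of_pos hb, le_top,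
      ht.trans (Real.exp_pos _).le]
  · rw [negLog_of_pos ht, ← EReal.coe_mul, EReal.coe_le_coe_iff, ← Real.log_le_iff_le_exp ht,
      le_neg, div_le_iff₀' hb]

theorem sum_coe_mul_of_mem_stdSimplex {X : Type*} [Fintype X] (P : stdSimplex ℝ X) (c : EReal) :
    ∑ x, (P x : EReal) * c = c := by
  classical
  suffices h : ∀ t : Finset X, ∑ x ∈ t, (P x : EReal) * c = ((∑ x ∈ t, P x : ℝ) : EReal) * c by
    rw [h, stdSimplex.sum_eq_one, EReal.coe_one, one_mul]
  intro t
  induction t using Finset.induction_on with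
  | empty => simp
  | insert x t hx ih =>
    rw [sum_insert hx, sum_insert hx, ih, EReal.coe_add]
    exact (EReal.right_distrib_of_nonneg (EReal.coe_nonneg.2 (P.2.1 x))
      (EReal.coe_nonneg.2 (sum_nonneg fun x _ => P.2.1 x))).symm

end NegLog

section Testing

variable {A : Type*} [Fintype A]

/-- The overlap `∑ min (p, q)` of two laws: the least total error of a test between them. -/
def overlap (p q : A → ℝ) : ℝ :=
  ∑ a, min (p a) (q a)

theorem overlap_le_add (p q : A → ℝ) (D : A → Prop) [DecidablePred D] :
    overlap p q ≤ ∑ a with D a, p a + ∑ a with ¬ D a, q a := by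
  rw [overlap, ← sum_filter_add_sum_filter_not univ D]
  exact add_le_add (sum_le_sum fun a _ => min_le_left _ _) (sum_le_sum fun a _ => min_le_right _ _)

theorem overlap_le_error_add_error {S : Type*} [DecidableEq S] (p : A → ℝ) {q : A → ℝ}
    (hq : ∀ a, 0 ≤ q a) (est : A → S) {s s' : S} (hs : s' ≠ s) :
    overlap p q ≤ ∑ a with est a ≠ s, p a + ∑ a with est a ≠ s', q a :=
  (overlap_le_add p q fun a => est a ≠ s).trans <| add_le_add le_rfl <|
    sum_filter_le_sum_filter hq fun _ _ ha => (not_not.1 ha).trans_ne hs.symm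

/-- The estimator maximises the likelihood `L s b` over `s`. -/
theorem exists_estimator_error_le_sum_overlap {S : Type*} [Fintype S] [DecidableEq S] [Nonempty S]
    {L : S → A → ℝ} (hL : ∀ s a, 0 ≤ L s a) :
    ∃ est : A → S, ∀ s, ∑ a with est a ≠ s, L s a ≤ ∑ s' with s' ≠ s, overlap (L s) (L s') := by
  choose est h_est using fun a => Finite.exists_max fun s => L s a
  refine ⟨est, fun s => ?_⟩
  calc ∑ a with est a ≠ s, L s a
      = ∑ a, ∑ s' with s' ≠ s, if est a = s' then L s a else 0 := by
        rw [sum_filter]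
        refine sum_congr rfl fun a _ => ?_
        rw [sum_ite_eq]
        simp only [mem_filter, mem_univ, true_and]
    _ ≤ ∑ a, ∑ s' with s' ≠ s, min (L s a) (L s' a) := by
        refine sum_le_sum fun a _ => sum_le_sum fun s' _ => ?_
        split_ifs with h
        · exact le_min le_rfl (h ▸ h_est a s)
        · exact le_min (hL s a) (hL s' a)
    _ = ∑ s' with s' ≠ s, overlap (L s) (L s') := sum_comm

/-- The Chernoff coefficient `∑ p^l q^(1-l)` of two laws. -/
def chernoffCoeff (l : ℝ) (p q : A → ℝ) : ℝ :=
  ∑ a, p a ^ l * q a ^ (1 - l)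

/-- The Chernoff information of two laws, the exponent of the error of the best test between them
from independent samples; it is `⊤` for laws of disjoint supports. -/
def chernoffInfo (p q : A → ℝ) : EReal :=
  ⨆ l ∈ Set.Icc (0 : ℝ) 1, negLog (chernoffCoeff l p q)

theorem overlap_le_chernoffCoeff {p q : A → ℝ} (hp : ∀ a, 0 ≤ p a) (hq : ∀ a, 0 ≤ q a) {l : ℝ}
    (hl : l ∈ Set.Icc (0 : ℝ) 1) : overlap p q ≤ chernoffCoeff l p q := by
  refine sum_le_sum fun a _ => ?_
  have h_min : 0 ≤ min (p a) (q a) := le_min (hp a) (hq a)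
  have hl' : 0 ≤ 1 - l := sub_nonneg.2 hl.2
  calc min (p a) (q a) = min (p a) (q a) ^ l * min (p a) (q a) ^ (1 - l) := by
        rw [← Real.rpow_add_of_nonneg h_min hl.1 hl', add_sub_cancel, Real.rpow_one]
    _ ≤ p a ^ l * q a ^ (1 - l) :=
        mul_le_mul (Real.rpow_le_rpow h_min (min_le_left _ _) hl.1)
          (Real.rpow_le_rpow h_min (min_le_right _ _) hl') (Real.rpow_nonneg h_min _)
          (Real.rpow_nonneg (hp a) _)

theorem chernoffCoeff_prodLaw {ι : Type*} [Fintype ι] [DecidableEq ι] (l : ℝ) {p q : ι → A → ℝ}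
    (hp : ∀ i a, 0 ≤ p i a) (hq : ∀ i a, 0 ≤ q i a) :
    chernoffCoeff l (prodLaw p) (prodLaw q) = ∏ i, chernoffCoeff l (p i) (q i) := by
  simp only [chernoffCoeff, ← sum_prodLaw fun i a => p i a ^ l * q i a ^ (1 - l), prodLaw,
    prod_mul_distrib, Real.finsetProd_rpow _ _ fun i _ => hp i _,
    Real.finsetProd_rpow _ _ fun i _ => hq i _]

theorem overlap_prodLaw_le_exp {p q : A → ℝ} (hp : ∀ a, 0 ≤ p a) (hq : ∀ a, 0 ≤ q a) {c : ℝ}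
    (hc : c < chernoffInfo p q) (n : ℕ) :
    overlap (prodLaw fun _ : Fin n => p) (prodLaw fun _ => q) ≤ Real.exp (-(n * c)) := by
  simp only [chernoffInfo, lt_iSup_iff] at hc
  obtain ⟨l, hl, hlc⟩ := hc
  calc overlap (prodLaw fun _ : Fin n => p) (prodLaw fun _ => q)
      ≤ chernoffCoeff l (prodLaw fun _ : Fin n => p) (prodLaw fun _ => q) :=
        overlap_le_chernoffCoeff (prodLaw_nonneg fun _ => hp) (prodLaw_nonneg fun _ => hq) hl
    _ = chernoffCoeff l p q ^ n := by
        rw [chernoffCoeff_prodLaw l (fun _ => hp) fun _ => hq, prod_const, card_univ,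
          Fintype.card_fin]
    _ ≤ Real.exp (-c) ^ n := pow_le_pow_left₀ (sum_nonneg fun a _ => mul_nonneg
        (Real.rpow_nonneg (hp a) _) (Real.rpow_nonneg (hq a) _)) (coe_le_negLog_iff.1 hlc.le) n
    _ = Real.exp (-(n * c)) := by rw [← Real.exp_nat_mul, mul_neg]

theorem eventually_exp_le_overlap_prodLaw {p q v : A → ℝ} (hp : ∀ a, 0 ≤ p a) (hq : ∀ a, 0 ≤ q a)
    (hv : v ∈ stdSimplex ℝ A) (hvp : ∀ a, p a = 0 → v a = 0) (hvq : ∀ a, q a = 0 → v a = 0) {c : ℝ}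
    (hpc : relEntropy v p < c) (hqc : relEntropy v q < c) :
    ∀ᶠ n : ℕ in atTop,
      Real.exp (-(n * c)) ≤ overlap (prodLaw fun _ : Fin n => p) (prodLaw fun _ => q) := by
  obtain ⟨b, hb, hbc⟩ := exists_between (max_lt hpc hqc)
  filter_upwards [
    eventually_sum_exp_mul_prodLaw_le hv hp hvp ((le_max_left _ _).trans_lt hb) (ε := 1 / 4)
      (by norm_num),
    eventually_sum_exp_mul_prodLaw_le hv hq hvq ((le_max_right _ _).trans_lt hb) (ε := 1 / 4)
      (by norm_num),
    eventually_mul_exp_le (neg_lt_neg hbc) 2] with n h_p h_q h_exp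
  rw [sum_filter] at h_p h_q
  have h_point : ∀ o : Fin n → A, prodLaw (fun _ => v) o ≤
      Real.exp (n * b) * min (prodLaw (fun _ => p) o) (prodLaw (fun _ => q) o) +
      ((if Real.exp (n * b) * prodLaw (fun _ => p) o ≤ prodLaw (fun _ => v) o
        then prodLaw (fun _ => v) o else 0) +
      if Real.exp (n * b) * prodLaw (fun _ => q) o ≤ prodLaw (fun _ => v) o
        then prodLaw (fun _ => v) o else 0) := by
    intro o
    have hv_nonneg := prodLaw_nonneg (fun _ => hv.1) o
    have h_min : 0 ≤ Real.exp (n * b) * min (prodLaw (fun _ => p) o) (prodLaw (fun _ => q) o) :=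
      mul_nonneg (Real.exp_pos _).le
        (le_min (prodLaw_nonneg (fun _ => hp) o) (prodLaw_nonneg (fun _ => hq) o))
    split_ifs with h1 h2 h2
    · linarith
    · linarith
    · linarith
    · rw [mul_min_of_nonneg _ _ (Real.exp_pos _).le]
      linarith [le_min (not_le.1 h1).le (not_le.1 h2).le]
  have h_sum := sum_le_sum fun o (_ : o ∈ univ) => h_point o
  rw [(prodLaw_mem_stdSimplex fun _ : Fin n => hv).2, sum_add_distrib, sum_add_distrib,
    ← mul_sum] at h_sum
  have h_half : Real.exp (-(n * b)) ≤
      2 * overlap (prodLaw fun _ : Fin n => p) (prodLaw fun _ => q) := by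
    rw [Real.exp_neg, inv_le_iff_one_le_mul₀ (Real.exp_pos _), overlap]
    linarith
  rw [mul_neg, mul_neg] at h_exp
  linarith

end Testing

section Tilting

variable {A : Type*}

/-- The summand `p^l q^(1-l)` of the Chernoff coefficient, restricted to the common support of `p`
and `q`. The restriction makes it continuous in `l` also at `0` and `1`, where `0 ^ 0 = 1` spoils
the unrestricted summand. -/
def tiltedWeight (p q : A → ℝ) (l : ℝ) (a : A) : ℝ :=
  if p a = 0 ∨ q a = 0 then 0
  else Real.exp (l * Real.log (p a) + (1 - l) * Real.log (q a))

theorem tiltedWeight_nonneg (p q : A → ℝ) (l : ℝ) (a : A) : 0 ≤ tiltedWeight p q l a := by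
  rw [tiltedWeight]
  split_ifs <;> positivity

theorem tiltedWeight_eq_rpow_mul_rpow {p q : A → ℝ} (hp : ∀ a, 0 ≤ p a) (hq : ∀ a, 0 ≤ q a) {l : ℝ}
    (hl : l ∈ Set.Ioo (0 : ℝ) 1) (a : A) :
    tiltedWeight p q l a = p a ^ l * q a ^ (1 - l) := by
  rw [tiltedWeight]
  split_ifs with h
  · rcases h with h | h
    · rw [h, Real.zero_rpow hl.1.ne', zero_mul]
    · rw [h, Real.zero_rpow (sub_pos.2 hl.2).ne', mul_zero]
  · rw [not_or] at h
    rw [Real.rpow_def_of_pos ((hp a).lt_of_ne' h.1), Real.rpow_def_of_pos ((hq a).lt_of_ne' h.2),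
      ← Real.exp_add, mul_comm l, mul_comm (1 - l)]

theorem log_tiltedWeight {p q : A → ℝ} {l : ℝ} {a : A} (h : tiltedWeight p q l a ≠ 0) :
    Real.log (tiltedWeight p q l a) = l * Real.log (p a) + (1 - l) * Real.log (q a) := by
  rw [tiltedWeight, ite_ne_left_iff] at h
  rw [tiltedWeight, if_neg h.1, Real.log_exp]

theorem hasDerivAt_tiltedWeight (p q : A → ℝ) (l : ℝ) (a : A) :
    HasDerivAt (fun l => tiltedWeight p q l a)
      (tiltedWeight p q l a * (Real.log (p a) - Real.log (q a))) l := by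
  simp only [tiltedWeight]
  split_ifs with h
  · simpa only [zero_mul] using hasDerivAt_const l (0 : ℝ)
  · have h_exponent := ((hasDerivAt_id' l).mul_const (Real.log (p a))).fun_add
      (((hasDerivAt_id' l).const_sub 1).mul_const (Real.log (q a)))
    exact h_exponent.exp.congr_deriv (by ring)

variable [Fintype A]

theorem exp_neg_le_sum_tiltedWeight {p q : A → ℝ} (hp : ∀ a, 0 ≤ p a) (hq : ∀ a, 0 ≤ q a) {c : ℝ}
    (hc : chernoffInfo p q ≤ c) {l : ℝ} (hl : l ∈ Set.Icc (0 : ℝ) 1) :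
    Real.exp (-c) ≤ ∑ a, tiltedWeight p q l a := by
  have h_cont : Continuous fun l => ∑ a, tiltedWeight p q l a :=
    continuous_finsetSum _ fun a _ =>
      continuous_iff_continuousAt.2 fun l => (hasDerivAt_tiltedWeight p q l a).continuousAt
  have h_Ioo : ∀ l ∈ Set.Ioo (0 : ℝ) 1, Real.exp (-c) ≤ ∑ a, tiltedWeight p q l a := by
    intro l hl
    have h_le : negLog (chernoffCoeff l p q) ≤ c :=
      (le_iSup₂_of_le l (Set.Ioo_subset_Icc_self hl) le_rfl).trans hc
    simpa only [chernoffCoeff, tiltedWeight_eq_rpow_mul_rpow hp hq hl] using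
      negLog_le_coe_iff.1 h_le
  rw [← closure_Ioo zero_ne_one] at hl
  exact closure_minimal (t := {l | Real.exp (-c) ≤ ∑ a, tiltedWeight p q l a}) h_Ioo
    (isClosed_le continuous_const h_cont) hl

theorem mul_sub_nonneg_of_isMinOn {s : Set ℝ} (hs : Convex ℝ s) {f : ℝ → ℝ} {f' x y : ℝ}
    (hf : HasDerivAt f f' x) (hx : x ∈ s) (h_min : IsMinOn f s x) (hy : y ∈ s) :
    0 ≤ f' * (y - x) := by
  have h := h_min.localize.hasFDerivWithinAt_nonneg hf.hasFDerivAt.hasFDerivWithinAt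
    (sub_mem_posTangentConeAt_of_segment_subset (hs.segment_subset hx hy))
  simpa [mul_comm] using h

/-- The tilted law `p^l q^(1-l) / ∑ p^l q^(1-l)` on the common support of `p` and `q`. -/
def tiltedLaw (p q : A → ℝ) (l : ℝ) (a : A) : ℝ :=
  tiltedWeight p q l a / ∑ b, tiltedWeight p q l b

theorem tiltedLaw_mem_stdSimplex {p q : A → ℝ} {l : ℝ} (hl : 0 < ∑ a, tiltedWeight p q l a) :
    tiltedLaw p q l ∈ stdSimplex ℝ A :=
  ⟨fun a => div_nonneg (tiltedWeight_nonneg p q l a) hl.le, by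
    simp only [tiltedLaw, ← sum_div, div_self hl.ne']⟩

theorem relEntropy_tiltedLaw {p q : A → ℝ} {l : ℝ} (hl : 0 < ∑ a, tiltedWeight p q l a)
    (r : A → ℝ) : relEntropy (tiltedLaw p q l) r =
      (∑ a, tiltedWeight p q l a *
        (l * Real.log (p a) + (1 - l) * Real.log (q a) - Real.log (r a))) /
        (∑ a, tiltedWeight p q l a) - Real.log (∑ a, tiltedWeight p q l a) := by
  have h_one := (tiltedLaw_mem_stdSimplex hl).2
  calc relEntropy (tiltedLaw p q l) r
      = ∑ a, (tiltedWeight p q l a * (l * Real.log (p a) + (1 - l) * Real.log (q a) -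
          Real.log (r a)) / (∑ a, tiltedWeight p q l a) -
          tiltedLaw p q l a * Real.log (∑ a, tiltedWeight p q l a)) := by
        refine sum_congr rfl fun a _ => ?_
        by_cases h : tiltedWeight p q l a = 0
        · simp only [tiltedLaw, h, zero_div, zero_mul, sub_zero]
        · rw [tiltedLaw, Real.log_div h hl.ne', log_tiltedWeight h]
          ring
    _ = _ := by rw [sum_sub_distrib, ← sum_div, ← sum_mul, h_one, one_mul]

/-- The tilting parameter minimises `∑ p^l q^(1-l)`, so that the derivative there, which is the
difference of the two relative entropies up to a factor, has the right sign at an end point and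
vanishes otherwise. -/
theorem exists_relEntropy_le_of_chernoffInfo_le {p q : A → ℝ} (hp : ∀ a, 0 ≤ p a)
    (hq : ∀ a, 0 ≤ q a) {c : ℝ} (hc : chernoffInfo p q ≤ c) :
    ∃ v ∈ stdSimplex ℝ A, (∀ a, p a = 0 → v a = 0) ∧ (∀ a, q a = 0 → v a = 0) ∧
      relEntropy v p ≤ c ∧ relEntropy v q ≤ c := by
  have h_deriv : ∀ l, HasDerivAt (fun l => ∑ a, tiltedWeight p q l a)
      (∑ a, tiltedWeight p q l a * (Real.log (p a) - Real.log (q a))) l := fun l =>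
    HasDerivAt.fun_sum fun a _ => hasDerivAt_tiltedWeight p q l a
  obtain ⟨l, hl, h_min⟩ := isCompact_Icc.exists_isMinOn (Set.nonempty_Icc.2 zero_le_one)
    fun l (_ : l ∈ Set.Icc (0 : ℝ) 1) => (h_deriv l).continuousAt.continuousWithinAt
  have h_exp := exp_neg_le_sum_tiltedWeight hp hq hc hl
  have h_slope := fun y hy => mul_sub_nonneg_of_isMinOn (convex_Icc 0 1) (h_deriv l) hl h_min
    (y := y) hy
  have h_pos := (Real.exp_pos _).trans_le h_exp
  have h_log : -Real.log (∑ a, tiltedWeight p q l a) ≤ c :=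
    neg_le.1 ((Real.le_log_iff_exp_le h_pos).2 h_exp)
  have h_relEntropy : ∀ r : A → ℝ, ∀ k : ℝ,
      0 ≤ (∑ a, tiltedWeight p q l a * (Real.log (p a) - Real.log (q a))) * (k - l) →
      (∀ a, l * Real.log (p a) + (1 - l) * Real.log (q a) - Real.log (r a) =
        -((Real.log (p a) - Real.log (q a)) * (k - l))) →
      relEntropy (tiltedLaw p q l) r ≤ c := by
    intro r k hk hr
    simp only [relEntropy_tiltedLaw h_pos, hr, mul_neg, sum_neg_distrib, ← mul_assoc, ← sum_mul,
      neg_div]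
    linarith [div_nonneg hk h_pos.le]
  exact ⟨tiltedLaw p q l, tiltedLaw_mem_stdSimplex h_pos,
    fun a ha => by simp only [tiltedLaw, tiltedWeight, ha, true_or, if_true, zero_div],
    fun a ha => by simp only [tiltedLaw, tiltedWeight, ha, or_true, if_true, zero_div],
    h_relEntropy p 1 (h_slope 1 ⟨zero_le_one, le_rfl⟩) fun a => by ring,
    h_relEntropy q 0 (h_slope 0 ⟨le_rfl, zero_le_one⟩) fun a => by ring⟩

theorem eventually_exp_le_overlap_of_chernoffInfo_lt {p q : A → ℝ} (hp : ∀ a, 0 ≤ p a)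
    (hq : ∀ a, 0 ≤ q a) {c : ℝ} (hc : chernoffInfo p q < c) :
    ∀ᶠ n : ℕ in atTop,
      Real.exp (-(n * c)) ≤ overlap (prodLaw fun _ : Fin n => p) (prodLaw fun _ => q) := by
  obtain ⟨b, hb, hbc⟩ := EReal.lt_iff_exists_real_btwn.1 hc
  obtain ⟨v, hv, hvp, hvq, hpb, hqb⟩ := exists_relEntropy_le_of_chernoffInfo_le hp hq hb.le
  have hbc' := EReal.coe_lt_coe_iff.1 hbc
  exact eventually_exp_le_overlap_prodLaw hp hq hv hvp hvq (hpb.trans_lt hbc') (hqb.trans_lt hbc')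

end Tilting

section Channel

variable {S X Y Z : Type*} {n : ℕ}

theorem OpenLoopCode.le_rate_iff [NeZero n] (C : OpenLoopCode S X Y Z n) {R : ℝ} :
    R ≤ C.rate ↔ Real.exp (n * R) ≤ C.M := by
  have hn : (0 : ℝ) < n := Nat.cast_pos.2 (NeZero.pos n)
  rw [rate, one_div_mul_eq_div, le_div_iff₀' hn,
    Real.le_log_iff_exp_le (Nat.cast_pos.2 C.M_pos)]

variable [Fintype Y] [Fintype Z]

theorem chanY_mem_stdSimplex (W : S → X → stdSimplex ℝ (Y × Z)) (s : S) (x : X) :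
    chanY W s x ∈ stdSimplex ℝ Y :=
  ⟨fun y => sum_nonneg fun z _ => (W s x).2.1 (y, z), by
    simp only [chanY, ← Fintype.sum_prod_type fun o => W s x o, stdSimplex.sum_eq_one]⟩

theorem chanZ_mem_stdSimplex (W : S → X → stdSimplex ℝ (Y × Z)) (s : S) (x : X) :
    chanZ W s x ∈ stdSimplex ℝ Z :=
  ⟨fun z => sum_nonneg fun y _ => (W s x).2.1 (y, z), by
    simp only [chanZ, ← Fintype.sum_prod_type_right fun o => W s x o, stdSimplex.sum_eq_one]⟩

theorem outProb_eq_sum_ite (W : S → X → stdSimplex ℝ (Y × Z)) (s : S) (x : Fin n → X)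
    (q : (Fin n → Y) → (Fin n → Z) → Prop) [∀ y z, Decidable (q y z)] :
    outProb W s x {o | q (fun i => (o i).1) fun i => (o i).2} =
      ∑ y, ∑ z, if q y z then ∏ i, W s (x i) (y i, z i) else 0 := by
  classical
  rw [outProb, ← (Equiv.arrowProdEquivProdArrow (Fin n) (fun _ => Y) fun _ => Z).symm.sum_comp,
    Fintype.sum_prod_type]
  simp only [Set.indicator_apply, Set.mem_ofPred_eq, Equiv.arrowProdEquivProdArrow_symm_apply]

theorem outProb_fst (W : S → X → stdSimplex ℝ (Y × Z)) (s : S) (x : Fin n → X)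
    (q : (Fin n → Y) → Prop) [DecidablePred q] :
    outProb W s x {o | q fun i => (o i).1} = ∑ y with q y, blockChannel (chanY W s) x y := by
  rw [outProb_eq_sum_ite W s x fun y _ => q y, sum_filter]
  refine sum_congr rfl fun y _ => ?_
  split_ifs
  · exact sum_prodLaw fun i z => W s (x i) (y i, z)
  · exact sum_const_zero

theorem outProb_snd (W : S → X → stdSimplex ℝ (Y × Z)) (s : S) (x : Fin n → X)
    (q : (Fin n → Z) → Prop) [DecidablePred q] :
    outProb W s x {o | q fun i => (o i).2} = ∑ z with q z, blockChannel (chanZ W s) x z := by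
  rw [outProb_eq_sum_ite W s x fun _ z => q z, sum_comm, sum_filter]
  refine sum_congr rfl fun z _ => ?_
  split_ifs
  · exact sum_prodLaw fun i y => W s (x i) (y, z i)
  · exact sum_const_zero

namespace OpenLoopCode

theorem commError_le_iff [Finite S] [Nonempty S] (C : OpenLoopCode S X Y Z n)
    (W : S → X → stdSimplex ℝ (Y × Z)) {ε : ℝ} :
    C.commError W ≤ ε ↔
      ∀ s w, ∑ y with C.dec y ≠ w, blockChannel (chanY W s) (C.enc w) y ≤ ε := by
  have : Nonempty (Fin C.M) := ⟨⟨0, C.M_pos⟩⟩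
  simp only [commError, ciSup_le_iff (Set.finite_range _).bddAbove, Prod.forall]
  exact forall₂_congr fun s w => by rw [outProb_fst W s _ fun y => C.dec y ≠ w]

theorem detError_le_iff [Finite S] [DecidableEq S] [Nonempty S] (C : OpenLoopCode S X Y Z n)
    (W : S → X → stdSimplex ℝ (Y × Z)) {ε : ℝ} :
    C.detError W ≤ ε ↔
      ∀ s w, ∑ z with C.est (C.enc w) z ≠ s, blockChannel (chanZ W s) (C.enc w) z ≤ ε := by
  have : Nonempty (Fin C.M) := ⟨⟨0, C.M_pos⟩⟩
  simp only [detError, ciSup_le_iff (Set.finite_range _).bddAbove, Prod.forall]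
  exact forall₂_congr fun s w => by rw [outProb_snd W s _ fun z => C.est (C.enc w) z ≠ s]

theorem coe_le_detExponent_iff [NeZero n] (C : OpenLoopCode S X Y Z n)
    (W : S → X → stdSimplex ℝ (Y × Z)) {E : ℝ} :
    (E : EReal) ≤ C.detExponent W ↔ C.detError W ≤ Real.exp (-(n * E)) := by
  have hn : (0 : ℝ) < n := Nat.cast_pos.2 (NeZero.pos n)
  rw [detExponent, coe_le_mul_negLog_iff (one_div_pos.2 hn), div_div_eq_mul_div, div_one,
    mul_comm E]

end OpenLoopCode

end Channel

section Symmetry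

variable {X Z : Type*}

/-- All inputs lead to the same pair of output laws under the channels `U` and `V`, up to a
permutation of the outputs that is common to `U` and `V`. -/
def JointlySymmetric (U V : X → Z → ℝ) : Prop :=
  ∀ x x', ∃ π : Equiv.Perm Z, U x = U x' ∘ π ∧ V x = V x' ∘ π

namespace JointlySymmetric

variable {U V : X → Z → ℝ}

theorem of_forall_exists (x₀ : X)
    (h : ∀ x, ∃ π : Equiv.Perm Z, U x = U x₀ ∘ π ∧ V x = V x₀ ∘ π) : JointlySymmetric U V := by
  intro x x'
  obtain ⟨π, hU, hV⟩ := h x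
  obtain ⟨π', hU', hV'⟩ := h x'
  refine ⟨π.trans π'.symm, ?_, ?_⟩ <;> ext z
  · simp only [hU, hU', Function.comp_apply, Equiv.trans_apply, Equiv.apply_symm_apply]
  · simp only [hV, hV', Function.comp_apply, Equiv.trans_apply, Equiv.apply_symm_apply]

variable [Fintype Z]

theorem chernoffCoeff_eq (h : JointlySymmetric U V) (l : ℝ) (x x' : X) :
    chernoffCoeff l (U x) (V x) = chernoffCoeff l (U x') (V x') := by
  obtain ⟨π, hU, hV⟩ := h x x'
  rw [hU, hV]
  exact Equiv.sum_comp π fun z => U x' z ^ l * V x' z ^ (1 - l)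

theorem overlap_blockChannel_eq (h : JointlySymmetric U V) {n : ℕ} (x : Fin n → X) (x₀ : X) :
    overlap (blockChannel U x) (blockChannel V x) =
      overlap (prodLaw fun _ : Fin n => U x₀) (prodLaw fun _ => V x₀) := by
  choose π hU hV using fun i => h (x i) x₀
  refine Fintype.sum_equiv (Equiv.piCongrRight π) _ _ fun z => ?_
  simp only [blockChannel, prodLaw, hU, hV, Function.comp_apply, Equiv.piCongrRight_apply,
    Pi.map_apply]

end JointlySymmetric

variable {S Y : Type*} [Fintype X] [Fintype Y] [Fintype Z] {W : S → X → stdSimplex ℝ (Y × Z)}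

theorem phi_eq_iInf_chernoffInfo
    (hW : Pairwise fun s s' => JointlySymmetric (chanZ W s) (chanZ W s'))
    (P : stdSimplex ℝ X) (x₀ : X) :
    phi W P = ⨅ (s : S) (s' : S) (_ : s' ≠ s), chernoffInfo (chanZ W s x₀) (chanZ W s' x₀) := by
  refine iInf_congr fun s => iInf_congr fun s' => iInf_congr fun hs =>
    iSup_congr fun l => iSup_congr fun _ => ?_
  rw [← sum_coe_mul_of_mem_stdSimplex P (negLog _)]
  refine sum_congr rfl fun x _ => ?_
  rw [← (hW hs.symm).chernoffCoeff_eq l x x₀]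
  rfl

end Symmetry

section Region

theorem continuous_mutualInfo {X Y : Type*} [Fintype X] [Fintype Y] (U : X → Y → ℝ) :
    Continuous fun P : stdSimplex ℝ X => mutualInfo P U := by
  have h_eval : ∀ x, Continuous fun P : stdSimplex ℝ X => P x := fun x =>
    (continuous_apply x).comp continuous_subtype_val
  refine Continuous.sub (continuous_finsetSum _ fun y _ => Real.continuous_negMulLog.comp ?_) ?_
  · exact continuous_finsetSum _ fun x _ => (h_eval x).mul continuous_const
  · exact continuous_finsetSum _ fun x _ => (h_eval x).mul continuous_const

theorem isClosed_setOf_le_and_le (R : ℝ) (E : EReal) :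
    IsClosed {p : ℝ × ℝ | 0 ≤ p.1 ∧ 0 ≤ p.2 ∧ p.1 ≤ R ∧ (p.2 : EReal) ≤ E} :=
  (isClosed_le continuous_const continuous_fst).inter <|
    (isClosed_le continuous_const continuous_snd).inter <|
    (isClosed_le continuous_fst continuous_const).inter <|
    isClosed_le (continuous_coe_real_ereal.comp continuous_snd) continuous_const

variable {S X Y Z : Type*} [Fintype Y] [Fintype Z] {W : S → X → stdSimplex ℝ (Y × Z)}

theorem OpenLoopCode.overlap_le_two_mul_detError [Finite S] [Nonempty S] {n : ℕ}
    (C : OpenLoopCode S X Y Z n) (W : S → X → stdSimplex ℝ (Y × Z)) {s s' : S} (hs : s' ≠ s)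
    (w : Fin C.M) :
    overlap (blockChannel (chanZ W s) (C.enc w)) (blockChannel (chanZ W s') (C.enc w)) ≤
      2 * C.detError W := by
  classical
  have h_err := (C.detError_le_iff W).1 le_rfl
  have h := overlap_le_error_add_error (blockChannel (chanZ W s) (C.enc w))
    (blockChannel_mem_stdSimplex (chanZ_mem_stdSimplex W s') (C.enc w)).1 (C.est (C.enc w)) hs
  linarith [h_err s w, h_err s' w]

theorem exponent_le_chernoffInfo_of_achievable [Finite S] [Nonempty S] {R E : ℝ}
    (h : Achievable W R E) {s s' : S} (hs : s' ≠ s)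
    (h_symm : JointlySymmetric (chanZ W s) (chanZ W s')) (x₀ : X) :
    (E : EReal) ≤ chernoffInfo (chanZ W s x₀) (chanZ W s' x₀) := by
  by_contra! h_lt
  obtain ⟨c, hc, hcE⟩ := EReal.lt_iff_exists_real_btwn.1 h_lt
  obtain ⟨b, hcb, hbE⟩ := exists_between (EReal.coe_lt_coe_iff.1 hcE)
  obtain ⟨N, hN⟩ := eventually_atTop.1 <|
    (eventually_exp_le_overlap_of_chernoffInfo_lt (chanZ_mem_stdSimplex W s x₀).1
      (chanZ_mem_stdSimplex W s' x₀).1 hc).and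
    (eventually_mul_exp_le (neg_lt_neg hcb) 3)
  obtain ⟨n, hn, C, -, h_det, -⟩ := h (E - b) (sub_pos.2 hbE) N
  obtain ⟨h_overlap, h_exp⟩ := hN n hn.le
  have : NeZero n := ⟨hn.ne_bot⟩
  have h_test := C.overlap_le_two_mul_detError W hs ⟨0, C.M_pos⟩
  rw [h_symm.overlap_blockChannel_eq _ x₀] at h_test
  rw [C.coe_le_detExponent_iff, sub_sub_cancel] at h_det
  rw [mul_neg, mul_neg] at h_exp
  linarith [Real.exp_pos (-(n * b))]

variable [Fintype X]

theorem exists_isGreatest_compoundInfo [Fintype S] [Nonempty S] [Nonempty X]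
    (W : S → X → stdSimplex ℝ (Y × Z)) :
    ∃ P : stdSimplex ℝ X,
      IsGreatest (Set.range fun P : stdSimplex ℝ X => compoundInfo W P) (compoundInfo W P) := by
  classical
  have : Nonempty (stdSimplex ℝ X) := ⟨⟨_, single_mem_stdSimplex ℝ (Classical.arbitrary X)⟩⟩
  have : CompactSpace (stdSimplex ℝ X) := isCompact_iff_compactSpace.1 (isCompact_stdSimplex ℝ X)
  have h_cont : Continuous fun P : stdSimplex ℝ X => compoundInfo W P :=
    Continuous.finset_inf'_apply _ fun s _ => continuous_mutualInfo _
  obtain ⟨_, ⟨P, rfl⟩, hP⟩ := (isCompact_range h_cont).exists_isGreatest (Set.range_nonempty _)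
  exact ⟨P, ⟨P, rfl⟩, hP⟩

theorem OpenLoopCode.exists_rate_le_compoundInfo [Fintype S] [Nonempty S] {n : ℕ} [NeZero n]
    (C : OpenLoopCode S X Y Z n) {ε : ℝ} (hC : C.commError W ≤ ε) :
    ∃ P : stdSimplex ℝ X, (1 - ε) * C.rate - 1 / n ≤ compoundInfo W P := by
  have : Nonempty (Fin C.M) := ⟨⟨0, C.M_pos⟩⟩
  have hn : (0 : ℝ) < n := Nat.cast_pos.2 (NeZero.pos n)
  refine ⟨empiricalLaw fun k : Fin C.M × Fin n => C.enc k.1 k.2, le_inf' _ _ fun s _ => ?_⟩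
  have h := log_card_le_mul_mutualInfo (chanY_mem_stdSimplex W s) C.enc C.dec
    ((C.commError_le_iff W).1 hC s)
  rw [Fintype.card_fin, ← div_le_iff₀' hn] at h
  exact le_of_eq_of_le (by rw [rate]; ring) h

theorem rate_le_of_achievable [Fintype S] [Nonempty S] {R E Rmax : ℝ} (h : Achievable W R E)
    (hRmax : ∀ P : stdSimplex ℝ X, compoundInfo W P ≤ Rmax) : R ≤ Rmax := by
  have h_tendsto : Tendsto (fun ε : ℝ => (1 - ε) * (R - ε) - ε) (𝓝[>] 0) (𝓝 R) := by
    have h_cont : Continuous fun ε : ℝ => (1 - ε) * (R - ε) - ε := by fun_prop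
    simpa using (h_cont.tendsto 0).mono_left nhdsWithin_le_nhds
  refine le_of_tendsto h_tendsto ?_
  filter_upwards [Ioo_mem_nhdsGT zero_lt_one] with ε hε
  obtain ⟨N, hN⟩ := exists_nat_gt (1 / ε)
  obtain ⟨n, hn, C, h_comm, -, h_rate⟩ := h ε hε.1 N
  have : NeZero n := ⟨hn.ne_bot⟩
  have h_inv : 1 / (n : ℝ) ≤ ε :=
    (one_div_lt hε.1 (Nat.cast_pos.2 (NeZero.pos n))).1 (hN.trans (Nat.cast_lt.2 hn)) |>.le
  obtain ⟨P, hP⟩ := C.exists_rate_le_compoundInfo h_comm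
  linarith [hRmax P, mul_le_mul_of_nonneg_left h_rate (sub_nonneg.2 hε.2.le)]

theorem exponent_le_phi_of_achievable [Finite S] [Nonempty S] [Nonempty X] {R E : ℝ}
    (h : Achievable W R E)
    (hW : Pairwise fun s s' => JointlySymmetric (chanZ W s) (chanZ W s')) (P : stdSimplex ℝ X) :
    (E : EReal) ≤ phi W P := by
  rw [phi_eq_iInf_chernoffInfo hW P (Classical.arbitrary X)]
  exact le_iInf fun s => le_iInf fun s' => le_iInf fun hs =>
    exponent_le_chernoffInfo_of_achievable h hs (hW hs.symm) _

theorem eventually_exists_estimator [Finite S] [DecidableEq S] [Nonempty S] [Nonempty X]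
    (hW : Pairwise fun s s' => JointlySymmetric (chanZ W s) (chanZ W s')) {P : stdSimplex ℝ X}
    {E : ℝ} (hE : E < phi W P) :
    ∀ᶠ n : ℕ in atTop, ∃ est : (Fin n → X) → (Fin n → Z) → S, ∀ s x,
      ∑ z with est x z ≠ s, blockChannel (chanZ W s) x z ≤ Real.exp (-(n * E)) := by
  have := Fintype.ofFinite S
  obtain ⟨b, hEb, hb⟩ := EReal.lt_iff_exists_real_btwn.1 hE
  rw [phi_eq_iInf_chernoffInfo hW P (Classical.arbitrary X)] at hb
  filter_upwards [eventually_mul_exp_le (neg_lt_neg (EReal.coe_lt_coe_iff.1 hEb))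
    (Fintype.card S)] with n h_exp
  choose est h_est using fun x : Fin n → X => exists_estimator_error_le_sum_overlap fun s =>
    (blockChannel_mem_stdSimplex (chanZ_mem_stdSimplex W s) x).1
  refine ⟨est, fun s x => (h_est x s).trans ?_⟩
  have h_overlap : ∀ s' ∈ ({s' | s' ≠ s} : Finset S),
      overlap (blockChannel (chanZ W s) x) (blockChannel (chanZ W s') x) ≤
        Real.exp (-(n * b)) := by
    intro s' hs'
    have hs := (mem_filter.1 hs').2
    rw [(hW hs.symm).overlap_blockChannel_eq x (Classical.arbitrary X)]
    exact overlap_prodLaw_le_exp (chanZ_mem_stdSimplex W s _).1 (chanZ_mem_stdSimplex W s' _).1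
      (hb.trans_le (iInf_le_of_le s <| iInf₂_le s' hs)) n
  calc ∑ s' with s' ≠ s, overlap (blockChannel (chanZ W s) x) (blockChannel (chanZ W s') x)
      ≤ #{s' | s' ≠ s} * Real.exp (-(n * b)) := by
        rw [← nsmul_eq_mul]
        exact sum_le_card_nsmul _ _ _ h_overlap
    _ ≤ Fintype.card S * Real.exp (-(n * b)) := by
        gcongr
        exact card_le_univ _
    _ ≤ Real.exp (-(n * E)) := by simpa only [mul_neg] using h_exp

theorem achievable_of_le [Fintype S] [Nonempty S] [Nonempty X]
    (hW : Pairwise fun s s' => JointlySymmetric (chanZ W s) (chanZ W s')) {P Q : stdSimplex ℝ X}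
    {R E : ℝ} (hR : R ≤ compoundInfo W P) (hE : (E : EReal) ≤ phi W Q) : Achievable W R E := by
  classical
  intro ε hε N
  have h_rate : R - ε < compoundInfo W P := (sub_lt_self R hε).trans_le hR
  have h_exponent : ((E - ε : ℝ) : EReal) < phi W Q :=
    (EReal.coe_lt_coe_iff.2 (sub_lt_self E hε)).trans_le hE
  obtain ⟨n, ⟨enc, dec, h_code⟩, ⟨est, h_est⟩, hn⟩ :=
    ((eventually_exists_block_code P (chanY_mem_stdSimplex W) h_rate
      (fun s => inf'_le _ (mem_univ s)) hε).and
    ((eventually_exists_estimator hW h_exponent).and (eventually_gt_atTop N))).exists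
  have : NeZero n := ⟨hn.ne_bot⟩
  let C : OpenLoopCode S X Y Z n :=
    { M := ⌈Real.exp (n * (R - ε))⌉₊, M_pos := Nat.ceil_pos.2 (Real.exp_pos _), enc, est, dec }
  exact ⟨n, hn, C, (C.commError_le_iff W).2 h_code,
    (C.coe_le_detExponent_iff W).2 <| (C.detError_le_iff W).2 fun s w => h_est s (enc w),
    C.le_rate_iff.2 (Nat.le_ceil _)⟩

end Region

end JointCommSensing

end

open JointCommSensing in
theorem mainTheorem6_general {S X Y Z : Type*} [Fintype S] [Nonempty S] [Fintype X] [Nonempty X]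
    [Fintype Y] [Fintype Z] (W : S → X → stdSimplex ℝ (Y × Z))
    (hW : Pairwise fun s s' => JointlySymmetric (chanZ W s) (chanZ W s')) :
    (∀ P Q : stdSimplex ℝ X, phi W P = phi W Q) ∧
    ∃ (Rmax : ℝ) (Emax : EReal),
      IsGreatest (Set.range fun P : stdSimplex ℝ X => compoundInfo W P) Rmax ∧
      IsGreatest (Set.range fun P : stdSimplex ℝ X => phi W P) Emax ∧
      openLoopRegion W =
        {p : ℝ × ℝ | 0 ≤ p.1 ∧ 0 ≤ p.2 ∧ p.1 ≤ Rmax ∧ (p.2 : EReal) ≤ Emax} := by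
  have h_phi : ∀ P Q : stdSimplex ℝ X, phi W P = phi W Q := fun P Q => by
    rw [phi_eq_iInf_chernoffInfo hW P (Classical.arbitrary X), ← phi_eq_iInf_chernoffInfo hW Q]
  obtain ⟨P, hP⟩ := exists_isGreatest_compoundInfo W
  refine ⟨h_phi, compoundInfo W P, phi W P, hP,
    ⟨⟨P, rfl⟩, Set.forall_mem_range.2 fun Q => (h_phi Q P).le⟩, ?_⟩
  rw [openLoopRegion, ← (isClosed_setOf_le_and_le _ _).closure_eq]
  congr! with ⟨R, E⟩ - -
  exact ⟨fun h => ⟨rate_le_of_achievable h fun Q => hP.2 ⟨Q, rfl⟩,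
    exponent_le_phi_of_achievable h hW P⟩, fun h => achievable_of_le hW h.1 h.2⟩

theorem mainTheorem6 {S X Y Z : Type*} [Fintype S] [Nonempty S] [Fintype X] [Fintype Y] [Fintype Z]
    (W : S → X → stdSimplex ℝ (Y × Z))
    (hsymm : ∃ x₀ : X, ∀ x : X, ∃ π : Equiv.Perm Z, ∀ (s : S) (z : Z),
      JointCommSensing.chanZ W s x z = JointCommSensing.chanZ W s x₀ (π z)) :
    (∀ P Q : stdSimplex ℝ X, JointCommSensing.phi W P = JointCommSensing.phi W Q) ∧
    ∃ (Rmax : ℝ) (Emax : EReal),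
      IsGreatest (Set.range fun P : stdSimplex ℝ X => JointCommSensing.compoundInfo W P) Rmax ∧
      IsGreatest (Set.range fun P : stdSimplex ℝ X => JointCommSensing.phi W P) Emax ∧
      JointCommSensing.openLoopRegion W =
        {p : ℝ × ℝ | 0 ≤ p.1 ∧ 0 ≤ p.2 ∧ p.1 ≤ Rmax ∧ (p.2 : EReal) ≤ Emax} := by
  obtain ⟨x₀, hx₀⟩ := hsymm
  have : Nonempty X := ⟨x₀⟩
  exact mainTheorem6_general W fun s s' _ => JointCommSensing.JointlySymmetric.of_forall_exists
    x₀ fun x => (hx₀ x).imp fun π hπ => ⟨funext (hπ s), funext (hπ s')⟩
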